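/- Let $r\ge 1$ be a fixed integer. An instance of {\sc Max-$r$-CSP} consists of a set $V$ of $n$ Boolean variables and a finite collection of constraints; each constraint is an arbitrary Boolean function of at most $r$ distinct variables of $V$ and has a positive integral weight. Let $A$ be the average, over all $2^n$ truth assignments, of the total weight of satisfied constraints. The parameterized problem {\sc Max-$r$-CSP-AA} is: given an instance $I$ and the parameter $k\in\mathbb{Z}_{\ge 0}$, decide whether there is a truth assignment for which the total weight of satisfied constraints is at least $A+k$. The size $|I|$ is the length of a standard encoding of $I$ (one symbol per variable; for each constraint the indices of its variables in binary, its truth table, and its weight in binary); in the input $(I,k)$ the parameter $k$ is written in binary. \textbf{Theorem.} For every fixed $r\ge 1$, {\sc Max-$r$-CSP-AA} admits a kernel of polynomial size. That is, there are a map $(I,k)\mapsto(I',k')$ from pairs to pairs, computable by a deterministic Turing machine in time polynomial in the length of the encoding of $(I,k)$, a function $f:\mathbb{N}\to\mathbb{N}$ and a polynomial $g$ such that, for all $I$ and $k$: (i) $(I,k)$ is a Yes-instance of {\sc Max-$r$-CSP-AA} if and only if $(I',k')$ is; (ii) $k'\le f(k)$; (iii) $|I'|\le g(k)$. -/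

import Mathlib

/-! ### Parameterized problems and kernelizations -/

/-- A parameterized problem: a type of instances, an injective encoding of the instances as words
over a finite alphabet, and the set of the pairs `(I, k)` that are answered with "yes". -/
structure ParamProblem where
  Inst : Type
  Sym : Type
  symFintype : Fintype Sym
  encode : Inst → List Sym
  encode_injective : Function.Injective encode
  yes : Set (Inst × ℕ)

namespace ParamProblem

/-- The size `|I|` of an instance: the length of the word that encodes it. -/
def size (P : ParamProblem) (I : P.Inst) : ℕ := (P.encode I).length

/-- The word that encodes the pair `(I, k)`: the word of `I`, followed by `k` in binary. -/
def encodePair (P : ParamProblem) (p : P.Inst × ℕ) : List (P.Sym ⊕ Bool) :=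
  (P.encode p.1).map Sum.inl ++ (Computability.encodeNat p.2).map Sum.inr

/-- `F` is a bikernelization from `P` to `Q`, with the bounds `f` and `g`: it is computed by a
(multi-stack) Turing machine in time polynomial in the length of the input word, it preserves the
answer, the new parameter is at most `f k`, and the new instance has size at most `g k`. -/
def IsBikernelization (P Q : ParamProblem) (F : P.Inst × ℕ → Q.Inst × ℕ) (f g : ℕ → ℕ) : Prop :=
  Nonempty (Turing.TM2ComputableInPolyTime P.encodePair Q.encodePair F) ∧
  (∀ I k, (I, k) ∈ P.yes ↔ F (I, k) ∈ Q.yes) ∧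
  (∀ I k, (F (I, k)).2 ≤ f k) ∧
  (∀ I k, Q.size (F (I, k)).1 ≤ g k)

/-- A kernelization is a bikernelization from a problem to itself. -/
def IsKernelization (P : ParamProblem) (F : P.Inst × ℕ → P.Inst × ℕ) (f g : ℕ → ℕ) : Prop :=
  IsBikernelization P P F f g

/-- `P` has a kernel of polynomial size: the size bound `g` is a polynomial. -/
def HasPolynomialSizeKernel (P : ParamProblem) : Prop :=
  ∃ (F : P.Inst × ℕ → P.Inst × ℕ) (f : ℕ → ℕ) (g : Polynomial ℕ),
    P.IsKernelization F f (fun k => g.eval k)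

end ParamProblem

/-! ### Weighted Boolean constraint satisfaction -/

namespace MaxCSP

/-- A Boolean function of at most `r` distinct variables among `n` variables, with a positive
integral weight. -/
structure Constraint (r n : ℕ) where
  arity : ℕ
  arity_le : arity ≤ r
  scope : Fin arity ↪ Fin n
  func : (Fin arity → Bool) → Bool
  weight : ℕ
  weight_pos : 0 < weight

/-- The constraint is satisfied by the truth assignment `x`. -/
def Constraint.sat {r n : ℕ} (c : Constraint r n) (x : Fin n → Bool) : Bool :=
  c.func (fun i => x (c.scope i))

/-- An instance: a number `n` of variables and a finite collection of constraints on them. -/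
structure Instance (r : ℕ) where
  n : ℕ
  constraints : List (Constraint r n)

/-- Total weight of the constraints that are satisfied by `x`. -/
def Instance.satWeight {r : ℕ} (I : Instance r) (x : Fin I.n → Bool) : ℕ :=
  ((I.constraints.filter (fun c => c.sat x)).map (fun c => c.weight)).sum

/-- Average, over all truth assignments, of the weight of the satisfied constraints. -/
def Instance.average {r : ℕ} (I : Instance r) : ℚ :=
  (∑ x : Fin I.n → Bool, (I.satWeight x : ℚ)) / 2 ^ I.n

/-! ### Encoding of instances -/

/-- The alphabet for instances. -/
inductive Sym
  | bit (b : Bool)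
  | var
  | arg
  | table
  | endMark
  deriving DecidableEq, Fintype

/-- A bit string with an end marker. -/
def encodeBits (l : List Bool) : List Sym := l.map Sym.bit ++ [Sym.endMark]

/-- A natural number in binary with an end marker. -/
def encodeNum (m : ℕ) : List Sym := encodeBits (Computability.encodeNat m)

/-- The numbers of the variables a constraint acts on, in order. -/
def Constraint.vars {r n : ℕ} (c : Constraint r n) : List ℕ :=
  List.ofFn (fun i => (c.scope i : ℕ))

/-- The truth table of a constraint: entry `i` is the value at the arguments given by the binary
digits of `i`. -/
def Constraint.truthTable {r n : ℕ} (c : Constraint r n) : List Bool :=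
  (List.range (2 ^ c.arity)).map (fun i => c.func (fun j => i.testBit j))

/-- The variables of a constraint (in binary), its truth table, and its weight (in binary). -/
def Constraint.encode {r n : ℕ} (c : Constraint r n) : List Sym :=
  c.vars.flatMap (fun v => Sym.arg :: encodeNum v) ++
    Sym.table :: (encodeBits c.truthTable ++ encodeNum c.weight)

/-- One symbol for each variable, followed by the constraints. -/
def Instance.encode {r : ℕ} (I : Instance r) : List Sym :=
  List.replicate I.n Sym.var ++ I.constraints.flatMap Constraint.encode

theorem encodeBits_append_inj {l l' : List Bool} {s t : List Sym}
    (h : encodeBits l ++ s = encodeBits l' ++ t) : l = l' ∧ s = t := by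
  induction l generalizing l' with
  | nil => cases l' <;> simp_all [encodeBits]
  | cons a l ih =>
    cases l' with
    | nil => simp [encodeBits] at h
    | cons b l' =>
      simp only [encodeBits, List.map_cons, List.cons_append, List.cons.injEq, Sym.bit.injEq] at h
      obtain ⟨h1, h2⟩ := ih h.2
      exact ⟨by rw [h.1, h1], h2⟩

theorem encodeNum_append_inj {l l' : ℕ} {s t : List Sym}
    (h : encodeNum l ++ s = encodeNum l' ++ t) : l = l' ∧ s = t := by
  obtain ⟨h1, h2⟩ := encodeBits_append_inj h
  exact ⟨Computability.encodingNatBool.encode_injective h1, h2⟩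

theorem encodeVars_append_inj {l l' : List ℕ} {s t : List Sym}
    (h : l.flatMap (fun v => Sym.arg :: encodeNum v) ++ Sym.table :: s =
      l'.flatMap (fun v => Sym.arg :: encodeNum v) ++ Sym.table :: t) : l = l' ∧ s = t := by
  induction l generalizing l' with
  | nil => cases l' <;> simp_all
  | cons a l ih =>
    cases l' with
    | nil => simp at h
    | cons b l' =>
      simp only [List.flatMap_cons, List.cons_append, List.append_assoc, List.cons.injEq,
        true_and] at h
      obtain ⟨h1, h2⟩ := encodeNum_append_inj h
      obtain ⟨h3, h4⟩ := ih h2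
      exact ⟨by rw [h1, h3], h4⟩

theorem Constraint.ext_of_lists {r n : ℕ} {c d : Constraint r n} (hv : c.vars = d.vars)
    (ht : c.truthTable = d.truthTable) (hw : c.weight = d.weight) : c = d := by
  obtain ⟨a, ha, e, f, w, hwpos⟩ := c
  obtain ⟨a', ha', e', f', w', hwpos'⟩ := d
  have hl : a = a' := by simpa [Constraint.vars] using congrArg List.length hv
  subst hl
  simp only at hw
  subst hw
  have he : e = e' := by
    ext i
    have := congrFun (List.ofFn_injective hv) i
    simpa using this
  have hf : f = f' := by
    funext y
    simp only [Constraint.truthTable, List.map_inj_left, List.mem_range] at ht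
    have := ht (Nat.ofBits y) (Nat.ofBits_lt_two_pow y)
    simpa [Nat.testBit_ofBits_lt] using this
  subst he hf
  rfl

theorem Constraint.encode_append_inj {r n : ℕ} {c d : Constraint r n} {s t : List Sym}
    (h : c.encode ++ s = d.encode ++ t) : c = d ∧ s = t := by
  simp only [Constraint.encode, List.append_assoc, List.cons_append] at h
  obtain ⟨h1, h2⟩ := encodeVars_append_inj h
  obtain ⟨h3, h4⟩ := encodeBits_append_inj h2
  obtain ⟨h5, h6⟩ := encodeNum_append_inj h4
  exact ⟨Constraint.ext_of_lists h1 h3 h5, h6⟩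

theorem Constraint.encode_head {r n : ℕ} (c : Constraint r n) :
    ∃ a l, c.encode = a :: l := by
  unfold Constraint.encode
  cases c.vars <;> simp

theorem encodeConstraints_injective {r n : ℕ} :
    Function.Injective (fun l : List (Constraint r n) => l.flatMap Constraint.encode) := by
  intro l l' h
  induction l generalizing l' with
  | nil =>
    cases l' with
    | nil => rfl
    | cons b l' =>
      obtain ⟨a, s, hs⟩ := b.encode_head
      simp [hs] at h
  | cons c l ih =>
    cases l' with
    | nil =>
      obtain ⟨a, s, hs⟩ := c.encode_head
      simp [hs] at h
    | cons b l' =>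
      simp only [List.flatMap_cons] at h
      obtain ⟨h1, h2⟩ := Constraint.encode_append_inj h
      rw [h1, ih h2]

theorem count_var_encode {r : ℕ} (I : Instance r) : I.encode.count Sym.var = I.n := by
  have hb : ∀ l : List Bool, Sym.var ∉ encodeBits l := by simp [encodeBits]
  have hc : ∀ c : Constraint r I.n, Sym.var ∉ c.encode := by
    intro c
    simp [Constraint.encode, encodeNum, hb]
  have : Sym.var ∉ I.constraints.flatMap Constraint.encode := by
    simp only [List.mem_flatMap, not_exists, not_and]
    exact fun c _ => hc c
  simp [Instance.encode, List.count_eq_zero_of_not_mem this]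

theorem Instance.encode_injective {r : ℕ} :
    Function.Injective (Instance.encode : Instance r → List Sym) := by
  intro I J h
  have hn : I.n = J.n := by rw [← count_var_encode I, ← count_var_encode J, h]
  obtain ⟨n, l⟩ := I
  obtain ⟨n', l'⟩ := J
  simp only at hn
  subst hn
  simp only [Instance.encode, List.append_cancel_left_eq] at h
  rw [encodeConstraints_injective h]

end MaxCSP

/-- Max-`r`-CSP-AA: given an instance and `k`, is there a truth assignment such that the total
weight of the satisfied constraints is at least `A + k`, where `A` is the average? -/
def MaxCSPAA (r : ℕ) : ParamProblem where
  Inst := MaxCSP.Instance r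
  Sym := MaxCSP.Sym
  symFintype := inferInstance
  encode := MaxCSP.Instance.encode
  encode_injective := MaxCSP.Instance.encode_injective
  yes := {p | ∃ x : Fin p.1.n → Bool, p.1.average + (p.2 : ℚ) ≤ (p.1.satWeight x : ℚ)}

/-!
Expand the satisfied weight minus its average as a multilinear polynomial in the signs of the
variables. It has degree at most `r` and no constant term, and scaling it by `2 ^ r` makes its
coefficients `c S` integers. Bonami's inequality bounds the fourth moment of such a polynomial by
`9 ^ r` times the square of its second moment, which is `∑ S, c S ^ 2`; as the mean is zero, the
polynomial therefore has a value larger than `2 ^ r * k` as soon as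
`∑ S, c S ^ 2 > 4 * 9 ^ r * (2 ^ r * k) ^ 2`, and then the answer is yes. Otherwise there are few
nonzero coefficients, all of them small, and each term `c S * walsh S` becomes a parity constraint
of weight `2 * |c S|` on the variables in `S`; the variables in no term are dropped.

For the running time, programs on stacks with bounded loops are compiled to Turing machines. Data
are binary trees, and a function is in `PolyTime` if such a program computes it on the codes of its
arguments. As the class is closed under composition, branching and loops that keep the size of the
data polynomial, the kernelization is put together from list operations and binary arithmetic.
-/

/-! ### Stack programs -/

/-- Structured programs over a family of stacks with alphabets `Γ k`. -/
inductive StackProg {K : Type} (Γ : K → Type) : Type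
  | skip : StackProg Γ
  | push (k : K) (a : Γ k) : StackProg Γ
  | seq (p q : StackProg Γ) : StackProg Γ
  /-- Pop a symbol from stack `k` and continue with the program it selects. -/
  | case (k : K) (f : Option (Γ k) → StackProg Γ) : StackProg Γ
  /-- Pop a symbol from stack `k`; if it satisfies `go`, run the program it selects and repeat. -/
  | loop (k : K) (go : Option (Γ k) → Bool) (f : Option (Γ k) → StackProg Γ) : StackProg Γ

namespace StackProg

variable {K : Type} [DecidableEq K] {Γ : K → Type}

/-- `Run p s t s'`: started with the stacks `s`, the program `p` halts after `t` steps with the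
stacks `s'`. -/
inductive Run : StackProg Γ → (∀ k, List (Γ k)) → ℕ → (∀ k, List (Γ k)) → Prop
  | skip (s) : Run skip s 1 s
  | push (k a s) : Run (push k a) s 1 (Function.update s k (a :: s k))
  | seq {p q s t s' t' s''} : Run p s t s' → Run q s' t' s'' → Run (seq p q) s (t + t') s''
  | case {k f s t s'} : Run (f (s k).head?) (Function.update s k (s k).tail) t s' →
      Run (case k f) s (1 + t) s'
  | loop_exit {k go f s} : go (s k).head? = false →
      Run (loop k go f) s 1 (Function.update s k (s k).tail)
  | loop_step {k go f s t s' t' s''} : go (s k).head? = true →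
      Run (f (s k).head?) (Function.update s k (s k).tail) t s' →
      Run (loop k go f) s' t' s'' → Run (loop k go f) s (1 + t + t') s''

/-- The program `p` takes the stacks `s` to the stacks `s'` in at most `t` steps. -/
def RunWithin (p : StackProg Γ) (s : ∀ k, List (Γ k)) (t : ℕ) (s' : ∀ k, List (Γ k)) : Prop :=
  ∃ u ≤ t, Run p s u s'

namespace RunWithin

variable {k : K} {p q : StackProg Γ} {f : Option (Γ k) → StackProg Γ} {go : Option (Γ k) → Bool}
  {s s' s'' s₁ : ∀ k, List (Γ k)} {t t' : ℕ} {o : Option (Γ k)}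

theorem mono (h : RunWithin p s t s') (ht : t ≤ t') : RunWithin p s t' s' :=
  let ⟨u, hu, run⟩ := h
  ⟨u, hu.trans ht, run⟩

theorem skip : RunWithin .skip s 1 s := ⟨1, le_rfl, .skip s⟩

theorem push {a : Γ k} (hs : Function.update s k (a :: s k) = s') :
    RunWithin (.push k a) s 1 s' := ⟨1, le_rfl, hs ▸ .push k a s⟩

theorem seq (h : RunWithin p s t s') (h' : RunWithin q s' t' s'') :
    RunWithin (.seq p q) s (t + t') s'' :=
  let ⟨u, hu, run⟩ := h
  let ⟨u', hu', run'⟩ := h'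
  ⟨u + u', add_le_add hu hu', run.seq run'⟩

theorem case (ho : (s k).head? = o) (hs : Function.update s k (s k).tail = s₁)
    (h : RunWithin (f o) s₁ t s') : RunWithin (.case k f) s (1 + t) s' := by
  subst ho hs
  obtain ⟨u, hu, run⟩ := h
  exact ⟨1 + u, by omega, .case run⟩

theorem loop_exit (ho : (s k).head? = o) (hgo : go o = false)
    (hs : Function.update s k (s k).tail = s') : RunWithin (.loop k go f) s 1 s' := by
  subst ho hs
  exact ⟨1, le_rfl, .loop_exit hgo⟩

theorem loop_step (ho : (s k).head? = o) (hgo : go o = true)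
    (hs : Function.update s k (s k).tail = s₁) (h : RunWithin (f o) s₁ t s')
    (h' : RunWithin (.loop k go f) s' t' s'') : RunWithin (.loop k go f) s (1 + t + t') s'' := by
  subst ho hs
  obtain ⟨u, hu, run⟩ := h
  obtain ⟨u', hu', run'⟩ := h'
  exact ⟨1 + u + u', by omega, .loop_step hgo run run'⟩

end RunWithin

section Lift

variable {K' : Type} [DecidableEq K'] {Γ' : K' → Type}

/-- The program that acts on the stacks in the range of `e` as the given one does. -/
def lift (e : K ↪ K') : StackProg (fun k => Γ' (e k)) → StackProg Γ'
  | skip => skip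
  | push k a => push (e k) a
  | seq p q => seq (p.lift e) (q.lift e)
  | case k f => case (e k) fun o => (f o).lift e
  | loop k go f => loop (e k) go fun o => (f o).lift e

theorem update_comp_embedding (e : K ↪ K') (S : ∀ k, List (Γ' k)) (k : K) (l : List (Γ' (e k))) :
    (fun j => Function.update S (e k) l (e j)) = Function.update (fun j => S (e j)) k l := by
  funext j
  obtain rfl | hj := eq_or_ne j k
  · simp
  · simp [hj]

theorem Run.lift {e : K ↪ K'} {p : StackProg fun k => Γ' (e k)} {s s' : ∀ k, List (Γ' (e k))}
    {t : ℕ} (h : Run p s t s') {S : ∀ k, List (Γ' k)} (hS : (fun k => S (e k)) = s) :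
    ∃ S', Run (p.lift e) S t S' ∧ (fun k => S' (e k)) = s' ∧ ∀ j ∉ Set.range e, S' j = S j := by
  have update_notMem : ∀ (S : ∀ k, List (Γ' k)) (k l), ∀ j ∉ Set.range e,
      Function.update S (e k) l j = S j := fun S k l j hj =>
    Function.update_of_ne (fun h => hj ⟨k, h.symm⟩) ..
  induction h generalizing S with subst hS
  | skip => exact ⟨S, .skip S, rfl, fun _ _ => rfl⟩
  | push k a =>
    exact ⟨_, .push (e k) a S, update_comp_embedding .., update_notMem _ _ _⟩
  | seq _ _ ihp ihq =>
    obtain ⟨S₁, h₁, hs₁, hj₁⟩ := ihp rfl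
    obtain ⟨S₂, h₂, hs₂, hj₂⟩ := ihq hs₁
    exact ⟨S₂, h₁.seq h₂, hs₂, fun j hj => (hj₂ j hj).trans (hj₁ j hj)⟩
  | case _ ih =>
    obtain ⟨S₁, h₁, hs₁, hj₁⟩ := ih (update_comp_embedding ..)
    exact ⟨S₁, .case h₁, hs₁, fun j hj => (hj₁ j hj).trans (update_notMem _ _ _ j hj)⟩
  | @loop_exit k go f _ hgo =>
    exact ⟨_, .loop_exit hgo, update_comp_embedding .., update_notMem _ _ _⟩
  | loop_step hgo _ _ ih ih' =>
    obtain ⟨S₁, h₁, hs₁, hj₁⟩ := ih (update_comp_embedding ..)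
    obtain ⟨S₂, h₂, hs₂, hj₂⟩ := ih' hs₁
    exact ⟨S₂, .loop_step hgo h₁ h₂, hs₂, fun j hj =>
      (hj₂ j hj).trans ((hj₁ j hj).trans (update_notMem _ _ _ j hj))⟩

end Lift

section Compile

/-- The labels of the compiled program. -/
def Label : StackProg Γ → Type
  | skip => Unit
  | push _ _ => Unit
  | seq p q => Label p ⊕ Label q
  | case _ f => Option (Σ o, Label (f o))
  | loop _ _ f => Option (Σ o, Label (f o))

instance instFintypeLabel [∀ k, Fintype (Γ k)] : (p : StackProg Γ) → Fintype (Label p)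
  | skip => inferInstanceAs (Fintype Unit)
  | push _ _ => inferInstanceAs (Fintype Unit)
  | seq p q =>
    letI := instFintypeLabel p
    letI := instFintypeLabel q
    inferInstanceAs (Fintype (Label p ⊕ Label q))
  | case _ f =>
    letI := fun o => instFintypeLabel (f o)
    inferInstanceAs (Fintype (Option (Σ o, Label (f o))))
  | loop _ _ f =>
    letI := fun o => instFintypeLabel (f o)
    inferInstanceAs (Fintype (Option (Σ o, Label (f o))))

/-- The label at which the compiled program starts. -/
def entry : (p : StackProg Γ) → Label p
  | skip => ()
  | push _ _ => ()
  | seq p _ => Sum.inl (entry p)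
  | case _ _ => none
  | loop _ _ _ => none

/-- The statements of the compiled program, in a machine in which its labels are embedded by `emb`
and which continues at `exit`. The internal state holds the symbols popped last. -/
def compile {L : Type} : (p : StackProg Γ) → (Label p → L) → L → Label p →
    Turing.TM2.Stmt Γ L (∀ k, Option (Γ k))
  | skip, _, exit, _ => .goto fun _ => exit
  | push k a, _, exit, _ => .push k (fun _ => a) (.goto fun _ => exit)
  | seq p q, emb, exit, l =>
    match l with
    | Sum.inl l => compile p (fun l => emb (Sum.inl l)) (emb (Sum.inr (entry q))) l
    | Sum.inr l => compile q (fun l => emb (Sum.inr l)) exit l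
  | case k f, emb, exit, l =>
    match l with
    | none => .pop k (fun v o => Function.update v k o)
        (.goto fun v => emb (some ⟨v k, entry (f (v k))⟩))
    | some ⟨o, l⟩ => compile (f o) (fun l => emb (some ⟨o, l⟩)) exit l
  | loop k go f, emb, exit, l =>
    match l with
    | none => .pop k (fun v o => Function.update v k o)
        (.goto fun v => if go (v k) then emb (some ⟨v k, entry (f (v k))⟩) else exit)
    | some ⟨o, l⟩ => compile (f o) (fun l => emb (some ⟨o, l⟩)) (emb none) l

/-- `Reaches M l s t l' s'`: from label `l` and stacks `s`, whatever its internal state, the machine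
`M` gets to label `l'` and stacks `s'` in exactly `t` steps. -/
def Reaches {L : Type} (M : L → Turing.TM2.Stmt Γ L (∀ k, Option (Γ k))) (l : L)
    (s : ∀ k, List (Γ k)) (t : ℕ) (l' : L) (s' : ∀ k, List (Γ k)) : Prop :=
  ∀ v, ∃ v', (flip bind (Turing.TM2.step M))^[t] (some ⟨some l, v, s⟩) = some ⟨some l', v', s'⟩

namespace Reaches

variable {L : Type} {M : L → Turing.TM2.Stmt Γ L (∀ k, Option (Γ k))} {l l' l'' : L}
  {s s' s'' : ∀ k, List (Γ k)} {t t' : ℕ}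

theorem trans (h : Reaches M l s t l' s') (h' : Reaches M l' s' t' l'' s'') :
    Reaches M l s (t + t') l'' s'' := fun v =>
  let ⟨v', hv'⟩ := h v
  let ⟨v'', hv''⟩ := h' v'
  ⟨v'', by rw [add_comm, Function.iterate_add_apply, hv', hv'']⟩

theorem of_goto (h : M l = .goto fun _ => l') : Reaches M l s 1 l' s := fun v =>
  ⟨v, by simp [flip, Turing.TM2.step, h, Turing.TM2.stepAux]⟩

theorem of_push {k : K} {a : Γ k} (h : M l = .push k (fun _ => a) (.goto fun _ => l')) :
    Reaches M l s 1 l' (Function.update s k (a :: s k)) := fun v =>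
  ⟨v, by simp [flip, Turing.TM2.step, h, Turing.TM2.stepAux]⟩

theorem of_pop {k : K} {next : Option (Γ k) → L}
    (h : M l = .pop k (fun v o => Function.update v k o) (.goto fun v => next (v k))) :
    Reaches M l s 1 (next (s k).head?) (Function.update s k (s k).tail) := fun v =>
  ⟨Function.update v k (s k).head?, by simp [flip, Turing.TM2.step, h, Turing.TM2.stepAux]⟩

end Reaches

theorem Run.reaches {p : StackProg Γ} {s s' : ∀ k, List (Γ k)} {t : ℕ} (h : Run p s t s')
    {L : Type} {M : L → Turing.TM2.Stmt Γ L (∀ k, Option (Γ k))} {emb : Label p → L} {exit : L}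
    (hM : ∀ l, M (emb l) = compile p emb exit l) : Reaches M (emb (entry p)) s t exit s' := by
  induction h generalizing exit with
  | skip => exact .of_goto (hM _)
  | push => exact .of_push (hM _)
  | seq _ _ ihp ihq =>
    exact (ihp fun l => hM (.inl l)).trans (ihq fun l => hM (.inr l))
  | @case k f s t s' _ ih =>
    have popped : Reaches M (emb none) s 1 _ _ :=
      .of_pop (next := fun o => emb (some ⟨o, entry (f o)⟩)) (hM none)
    exact popped.trans (ih fun l => hM (some ⟨_, l⟩))
  | @loop_exit k go f s hgo =>
    have popped : Reaches M (emb none) s 1 _ _ :=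
      .of_pop (next := fun o => if go o then emb (some ⟨o, entry (f o)⟩) else exit) (hM none)
    simp only [hgo, Bool.false_eq_true, if_false] at popped
    exact popped
  | @loop_step k go f s t s' t' s'' hgo _ _ ih ih' =>
    have popped : Reaches M (emb none) s 1 _ _ :=
      .of_pop (next := fun o => if go o then emb (some ⟨o, entry (f o)⟩) else exit) (hM none)
    simp only [hgo, if_true] at popped
    exact (popped.trans (ih fun l => hM (some ⟨_, l⟩))).trans (ih' hM)

/-- The machine that runs the program `p` and halts, with input stack `k₀` and output stack `k₁`. -/
def machine [Fintype K] [∀ k, Fintype (Γ k)] (p : StackProg Γ) (k₀ k₁ : K) : Turing.FinTM2 where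
  K := K
  k₀ := k₀
  k₁ := k₁
  Γ := Γ
  Λ := Option (Label p)
  main := some (entry p)
  σ := ∀ k, Option (Γ k)
  initialState := fun _ => none
  m
    -- `Turing.haltList` prescribes the internal state of a halted machine.
    | none => .load (fun _ _ => none) .halt
    | some l => compile p some none l

/-- The stacks on which everything but stack `k` is empty. -/
def single (k : K) (w : List (Γ k)) : ∀ j, List (Γ j) :=
  Function.update (fun _ => []) k w

theorem single_eq_dite (k₀ : K) (w : List (Γ k₀)) :
    single k₀ w = fun k => if h : k = k₀ then (by rw [h]; exact w) else [] := by
  funext k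
  obtain rfl | h := eq_or_ne k k₀
  · simp [single]
  · simp [single, h]

theorem computableInPolyTime [Finite K] [∀ k, Finite (Γ k)] {α β : Type} {k₀ k₁ : K}
    {ea : α → List (Γ k₀)} {eb : β → List (Γ k₁)} {f : α → β} (p : StackProg Γ)
    (q : Polynomial ℕ)
    (h : ∀ a, RunWithin p (single k₀ (ea a)) (q.eval (ea a).length) (single k₁ (eb (f a)))) :
    Nonempty (Turing.TM2ComputableInPolyTime ea eb f) := by
  have := Fintype.ofFinite K
  have := fun k => Fintype.ofFinite (Γ k)
  have outputs : ∀ a, Nonempty (Turing.TM2OutputsInTime (machine p k₀ k₁) (ea a)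
      (some (eb (f a))) ((q + 1).eval (ea a).length)) := by
    intro a
    obtain ⟨t, ht, run⟩ := h a
    obtain ⟨v, hv⟩ := run.reaches (M := (machine p k₀ k₁).m) (emb := some) (exit := none)
      (fun _ => rfl) fun _ => none
    refine ⟨⟨⟨t + 1, ?_⟩, by simpa using ht⟩⟩
    simp only [single_eq_dite] at hv
    rw [Function.iterate_succ_apply']
    exact congrArg (flip bind (Turing.TM2.step (machine p k₀ k₁).m)) hv
  refine ⟨{ tm := machine p k₀ k₁, inputAlphabet := .refl _, outputAlphabet := .refl _,
            time := q + 1, outputsFun := fun a => ?_ }⟩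
  have map_id : ∀ (k : K) (w : List (Γ k)), w.map (Equiv.refl (Γ k)).invFun = w :=
    fun k w => List.map_id w
  exact Classical.choice ((map_id k₀ (ea a)).symm ▸ (map_id k₁ (eb (f a))).symm ▸ outputs a)

end Compile

end StackProg

/-! ### Stack programs on binary trees -/

/-- The symbols of the serializations of trees, and a mark that separates stack segments. -/
inductive TreeToken
  | node
  | leaf
  | mark
  deriving DecidableEq

instance : Fintype TreeToken := ⟨{.node, .leaf, .mark}, fun a => by cases a <;> simp⟩

/-- The stacks of the programs on trees: a main stack, two auxiliary stacks, and a counter. -/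
inductive TreeReg
  | M
  | B
  | E
  | C
  deriving DecidableEq

instance : Fintype TreeReg := ⟨{.M, .B, .E, .C}, fun k => by cases k <;> simp⟩

/-- Programs that process binary trees on the main stack. -/
abbrev TreeProg := StackProg fun _ : TreeReg => TreeToken

/-- The serialization of a binary tree in prefix order. -/
def treeTokens : BinaryTree Unit → List TreeToken
  | .nil => [.leaf]
  | .node _ l r => .node :: (treeTokens l ++ treeTokens r)

theorem length_treeTokens (x : BinaryTree Unit) : (treeTokens x).length = 2 * x.numNodes + 1 := by
  induction x with
  | nil => rfl
  | node _ l r hl hr =>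
    simp only [treeTokens, BinaryTree.numNodes, List.length_cons, List.length_append, hl, hr]
    omega

theorem mark_notMem_treeTokens (x : BinaryTree Unit) : TreeToken.mark ∉ treeTokens x := by
  induction x with
  | nil => simp [treeTokens]
  | node _ l r hl hr => simp [treeTokens, hl, hr]

namespace TreeProg

open StackProg TreeReg

/-- The stacks with the given contents. -/
def regs (m b e c : List TreeToken) : TreeReg → List TreeToken
  | M => m
  | B => b
  | E => e
  | C => c

section Stacks

variable {m b e c l : List TreeToken} {a : TreeToken} {go : Option TreeToken → Bool}
  {f : Option TreeToken → TreeProg} {t t' : ℕ} {s s' : TreeReg → List TreeToken}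

theorem update_M : Function.update (regs m b e c) M l = regs l b e c := by
  funext k; cases k <;> rfl

theorem update_B : Function.update (regs m b e c) B l = regs m l e c := by
  funext k; cases k <;> rfl

theorem update_E : Function.update (regs m b e c) E l = regs m b l c := by
  funext k; cases k <;> rfl

theorem update_C : Function.update (regs m b e c) C l = regs m b e l := by
  funext k; cases k <;> rfl

theorem push_M : RunWithin (.push M a) (regs m b e c) 1 (regs (a :: m) b e c) :=
  .push update_M

theorem push_B : RunWithin (.push B a) (regs m b e c) 1 (regs m (a :: b) e c) :=
  .push update_B

theorem push_E : RunWithin (.push E a) (regs m b e c) 1 (regs m b (a :: e) c) :=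
  .push update_E

theorem push_C : RunWithin (.push C a) (regs m b e c) 1 (regs m b e (a :: c)) :=
  .push update_C

theorem case_M (h : RunWithin (f (some a)) (regs m b e c) t s) :
    RunWithin (.case M f) (regs (a :: m) b e c) (1 + t) s :=
  .case (o := some a) rfl update_M h

theorem loop_exit_M (h : go (some a) = false) :
    RunWithin (.loop M go f) (regs (a :: m) b e c) 1 (regs m b e c) :=
  .loop_exit (o := some a) rfl h update_M

theorem loop_exit_B (h : go (some a) = false) :
    RunWithin (.loop B go f) (regs m (a :: b) e c) 1 (regs m b e c) :=
  .loop_exit (o := some a) rfl h update_B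

theorem loop_exit_E (h : go (some a) = false) :
    RunWithin (.loop E go f) (regs m b (a :: e) c) 1 (regs m b e c) :=
  .loop_exit (o := some a) rfl h update_E

theorem loop_exit_C (h : go (some a) = false) :
    RunWithin (.loop C go f) (regs m b e (a :: c)) 1 (regs m b e c) :=
  .loop_exit (o := some a) rfl h update_C

theorem loop_step_M (hgo : go (some a) = true)
    (h : RunWithin (f (some a)) (regs m b e c) t s) (h' : RunWithin (.loop M go f) s t' s') :
    RunWithin (.loop M go f) (regs (a :: m) b e c) (1 + t + t') s' :=
  .loop_step (o := some a) rfl hgo update_M h h'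

theorem loop_step_B (hgo : go (some a) = true)
    (h : RunWithin (f (some a)) (regs m b e c) t s) (h' : RunWithin (.loop B go f) s t' s') :
    RunWithin (.loop B go f) (regs m (a :: b) e c) (1 + t + t') s' :=
  .loop_step (o := some a) rfl hgo update_B h h'

theorem loop_step_E (hgo : go (some a) = true)
    (h : RunWithin (f (some a)) (regs m b e c) t s) (h' : RunWithin (.loop E go f) s t' s') :
    RunWithin (.loop E go f) (regs m b (a :: e) c) (1 + t + t') s' :=
  .loop_step (o := some a) rfl hgo update_E h h'

theorem loop_step_C (hgo : go (some a) = true)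
    (h : RunWithin (f (some a)) (regs m b e c) t s) (h' : RunWithin (.loop C go f) s t' s') :
    RunWithin (.loop C go f) (regs m b e (a :: c)) (1 + t + t') s' :=
  .loop_step (o := some a) rfl hgo update_C h h'

end Stacks

/-- The loop of `traverse`: the symbols `node` on the counter stand for the trees still to be
read. -/
def traverseLoop (act : TreeToken → TreeProg) : TreeProg :=
  .loop C (· == some .node) fun _ => .case M fun
    | some .node => .seq (act .node) (.seq (.push C .node) (.push C .node))
    | some .leaf => act .leaf
    | _ => .skip

/-- The program that reads a tree from the main stack and applies `act` to each of its symbols. -/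
def traverse (act : TreeToken → TreeProg) : TreeProg :=
  .seq (.push C .mark) (.seq (.push C .node) (traverseLoop act))

/-- The program `act a` may push symbols to the auxiliary stacks, as described by `fb` and `fe`. -/
def ActsBy (act : TreeToken → TreeProg) (fb fe : TreeToken → List TreeToken → List TreeToken) :
    Prop :=
  ∀ a m b e c, RunWithin (act a) (regs m b e c) 2 (regs m (fb a b) (fe a e) c)

theorem traverseLoop_run {act : TreeToken → TreeProg}
    {fb fe : TreeToken → List TreeToken → List TreeToken} (hact : ActsBy act fb fe)
    (x : BinaryTree Unit) {m b e c : List TreeToken} {t : ℕ} {s : TreeReg → List TreeToken}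
    (rest : RunWithin (traverseLoop act) (regs m ((treeTokens x).foldl (flip fb) b)
      ((treeTokens x).foldl (flip fe) e) c) t s) :
    RunWithin (traverseLoop act) (regs (treeTokens x ++ m) b e (.node :: c))
      (10 * x.numNodes + 4 + t) s := by
  induction x generalizing m b e c t with
  | nil => exact (loop_step_C rfl (case_M (hact ..)) rest).mono (by omega)
  | node _ l r hl hr =>
    simp only [treeTokens, List.foldl_cons, List.foldl_append] at rest
    rw [treeTokens, List.cons_append, List.append_assoc]
    exact (loop_step_C rfl (case_M (.seq (hact ..) (.seq push_C push_C)))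
      (hl (c := .node :: c) (hr rest))).mono (by simp only [BinaryTree.numNodes]; omega)

theorem traverse_run {act : TreeToken → TreeProg}
    {fb fe : TreeToken → List TreeToken → List TreeToken} (hact : ActsBy act fb fe)
    (x : BinaryTree Unit) (m b e c : List TreeToken) :
    RunWithin (traverse act) (regs (treeTokens x ++ m) b e c) (10 * x.numNodes + 7)
      (regs m ((treeTokens x).foldl (flip fb) b) ((treeTokens x).foldl (flip fe) e) c) := by
  have exit : RunWithin (traverseLoop act) (regs m ((treeTokens x).foldl (flip fb) b)
      ((treeTokens x).foldl (flip fe) e) (.mark :: c)) 1 _ := loop_exit_C rfl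
  exact (RunWithin.seq push_C (.seq push_C (traverseLoop_run hact x exit))).mono (by omega)

theorem foldl_flip_cons {α : Type*} (l b : List α) :
    l.foldl (flip List.cons) b = l.reverse ++ b := by
  induction l generalizing b with
  | nil => rfl
  | cons a l ih => simp [ih, flip]

theorem foldl_flip_const {α β : Type*} (l : List α) (b : β) :
    l.foldl (flip fun _ b => b) b = b :=
  List.foldl_fixed ..

/-- The program that removes a tree from the main stack. -/
def drop : TreeProg := traverse fun _ => .skip

theorem drop_run (x : BinaryTree Unit) (m b e c : List TreeToken) :
    RunWithin drop (regs (treeTokens x ++ m) b e c) (10 * x.numNodes + 7) (regs m b e c) := by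
  have := traverse_run (act := fun _ => .skip) (fb := fun _ b => b) (fe := fun _ e => e)
    (fun _ _ _ _ _ => RunWithin.skip.mono one_le_two) x m b e c
  rwa [foldl_flip_const, foldl_flip_const] at this

/-- The program that moves a tree from the main stack to stack `B`, above a mark. -/
def stash : TreeProg := .seq (.push B .mark) (traverse fun a => .push B a)

theorem stash_run (x : BinaryTree Unit) (m b e c : List TreeToken) :
    RunWithin stash (regs (treeTokens x ++ m) b e c) (10 * x.numNodes + 8)
      (regs m ((treeTokens x).reverse ++ .mark :: b) e c) := by
  have := traverse_run (act := fun a => .push B a) (fb := .cons) (fe := fun _ e => e)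
    (fun _ _ _ _ _ => push_B.mono one_le_two) x m (.mark :: b) e c
  rw [foldl_flip_cons, foldl_flip_const] at this
  exact (RunWithin.seq push_B this).mono (by omega)

/-- The program that moves the symbols above the mark on stack `k` to the main stack. -/
def unstash (k : TreeReg) : TreeProg :=
  .loop k (fun o => o.isSome && o != some .mark) fun
    | some a => .push M a
    | none => .skip

theorem unstash_B_run_list {l : List TreeToken} (hl : TreeToken.mark ∉ l)
    (m b e c : List TreeToken) :
    RunWithin (unstash B) (regs m (l ++ .mark :: b) e c) (2 * l.length + 1)
      (regs (l.reverse ++ m) b e c) := by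
  induction l generalizing m with
  | nil => exact loop_exit_B rfl
  | cons a l ih =>
    obtain ⟨ha, hl⟩ := not_or.1 (List.mem_cons.not.1 hl)
    rw [List.reverse_cons, List.append_assoc]
    exact (loop_step_B (by simpa using Ne.symm ha) push_M (ih hl (a :: m))).mono
      (by simp only [List.length_cons]; omega)

theorem unstash_E_run_list {l : List TreeToken} (hl : TreeToken.mark ∉ l)
    (m b e c : List TreeToken) :
    RunWithin (unstash E) (regs m b (l ++ .mark :: e) c) (2 * l.length + 1)
      (regs (l.reverse ++ m) b e c) := by
  induction l generalizing m with
  | nil => exact loop_exit_E rfl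
  | cons a l ih =>
    obtain ⟨ha, hl⟩ := not_or.1 (List.mem_cons.not.1 hl)
    rw [List.reverse_cons, List.append_assoc]
    exact (loop_step_E (by simpa using Ne.symm ha) push_M (ih hl (a :: m))).mono
      (by simp only [List.length_cons]; omega)

theorem unstash_B_run (x : BinaryTree Unit) (m b e c : List TreeToken) :
    RunWithin (unstash B) (regs m ((treeTokens x).reverse ++ .mark :: b) e c)
      (4 * x.numNodes + 3) (regs (treeTokens x ++ m) b e c) := by
  have := unstash_B_run_list (l := (treeTokens x).reverse)
    (by simpa using mark_notMem_treeTokens x) m b e c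
  rw [List.reverse_reverse, List.length_reverse, length_treeTokens] at this
  exact this.mono (by omega)

theorem unstash_E_run (x : BinaryTree Unit) (m b e c : List TreeToken) :
    RunWithin (unstash E) (regs m b ((treeTokens x).reverse ++ .mark :: e) c)
      (4 * x.numNodes + 3) (regs (treeTokens x ++ m) b e c) := by
  have := unstash_E_run_list (l := (treeTokens x).reverse)
    (by simpa using mark_notMem_treeTokens x) m b e c
  rw [List.reverse_reverse, List.length_reverse, length_treeTokens] at this
  exact this.mono (by omega)

/-- The program that duplicates the tree on top of the main stack. -/
def dup : TreeProg :=
  .seq (.push B .mark) (.seq (.push E .mark)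
    (.seq (traverse fun a => .seq (.push B a) (.push E a)) (.seq (unstash B) (unstash E))))

theorem dup_run (x : BinaryTree Unit) (m b e c : List TreeToken) :
    RunWithin dup (regs (treeTokens x ++ m) b e c) (18 * x.numNodes + 15)
      (regs (treeTokens x ++ (treeTokens x ++ m)) b e c) := by
  have := traverse_run (act := fun a => .seq (.push B a) (.push E a)) (fb := .cons) (fe := .cons)
    (fun _ _ _ _ _ => .seq push_B push_E) x m (.mark :: b) (.mark :: e) c
  rw [foldl_flip_cons, foldl_flip_cons] at this
  exact (RunWithin.seq push_B (.seq push_E (.seq this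
    (.seq (unstash_B_run ..) (unstash_E_run ..))))).mono (by omega)

/-- The program that pushes a word onto the main stack. -/
def pushList : List TreeToken → TreeProg
  | [] => .skip
  | a :: l => .seq (pushList l) (.push M a)

theorem pushList_run (l m b e c : List TreeToken) :
    RunWithin (pushList l) (regs m b e c) (l.length + 1) (regs (l ++ m) b e c) := by
  induction l with
  | nil => exact .skip
  | cons a l ih => exact ih.seq push_M

end TreeProg

/-- Types whose elements are represented by binary trees. -/
class TreeCode (α : Type) where
  code : α → BinaryTree Unit
  code_injective : Function.Injective code

open TreeCode (code code_injective)

/-- The size of the tree that represents an element. -/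
def codeSize {α : Type} [TreeCode α] (a : α) : ℕ := (code a).numNodes

namespace TreeCode

variable {α β : Type} [TreeCode α] [TreeCode β]

instance : TreeCode (BinaryTree Unit) := ⟨id, Function.injective_id⟩

instance : TreeCode Bool where
  code
    | false => .node () .nil (.node () .nil .nil)
    | true => .node () (.node () .nil .nil) .nil
  code_injective := by rintro (_ | _) (_ | _) h <;> simp_all

instance : TreeCode (α × β) where
  code p := .node () (code p.1) (code p.2)
  code_injective p q h := by
    injection h with _ h₁ h₂
    exact Prod.ext (code_injective h₁) (code_injective h₂)

/-- The tree whose right spine carries the representations of the elements of the list. -/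
def codeList : List α → BinaryTree Unit
  | [] => .nil
  | a :: l => .node () (code a) (codeList l)

theorem codeList_injective : Function.Injective (codeList : List α → BinaryTree Unit) := by
  intro l l' h
  induction l generalizing l' with
  | nil => cases l' with
    | nil => rfl
    | cons b l' => cases h
  | cons a l ih => cases l' with
    | nil => cases h
    | cons b l' =>
      injection h with _ h₁ h₂
      rw [code_injective h₁, ih h₂]

instance : TreeCode (List α) := ⟨codeList, codeList_injective⟩

end TreeCode

section CodeSize

variable {α β : Type} [TreeCode α] [TreeCode β]

theorem codeSize_pair (a : α) (b : β) : codeSize (a, b) = codeSize a + codeSize b + 1 := rfl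

theorem codeSize_nil : codeSize ([] : List α) = 0 := rfl

theorem codeSize_cons (a : α) (l : List α) : codeSize (a :: l) = codeSize a + codeSize l + 1 := rfl

theorem codeSize_bool (b : Bool) : codeSize b = 2 := by cases b <;> rfl

theorem length_le_codeSize (l : List α) : l.length ≤ codeSize l := by
  induction l with
  | nil => exact le_rfl
  | cons a l ih => simp only [codeSize_cons, List.length_cons]; omega

end CodeSize

variable {α β γ : Type} [TreeCode α] [TreeCode β] [TreeCode γ]

/-- `f` is bounded by a polynomial in the size of its argument. -/
@[fun_prop]
def PolyBounded (f : α → ℕ) : Prop := ∃ q : Polynomial ℕ, ∀ a, f a ≤ q.eval (codeSize a)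

namespace PolyBounded

variable {f g : α → ℕ}

theorem mono (hg : PolyBounded g) (h : ∀ a, f a ≤ g a) : PolyBounded f :=
  let ⟨q, hq⟩ := hg
  ⟨q, fun a => (h a).trans (hq a)⟩

@[fun_prop]
theorem const (n : ℕ) : PolyBounded fun _ : α => n := ⟨Polynomial.C n, fun a => by simp⟩

@[fun_prop]
theorem codeSize : PolyBounded fun a : α => codeSize a := ⟨Polynomial.X, fun a => by simp⟩

@[fun_prop]
theorem add (hf : PolyBounded f) (hg : PolyBounded g) : PolyBounded fun a => f a + g a := by
  obtain ⟨p, hp⟩ := hf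
  obtain ⟨q, hq⟩ := hg
  exact ⟨p + q, fun a => by simpa using add_le_add (hp a) (hq a)⟩

@[fun_prop]
theorem mul (hf : PolyBounded f) (hg : PolyBounded g) : PolyBounded fun a => f a * g a := by
  obtain ⟨p, hp⟩ := hf
  obtain ⟨q, hq⟩ := hg
  exact ⟨p * q, fun a => by simpa using Nat.mul_le_mul (hp a) (hq a)⟩

theorem _root_.monotone_eval_nat (q : Polynomial ℕ) : Monotone fun n => q.eval n := by
  intro m n h
  induction q using Polynomial.induction_on' with
  | add p q hp hq => simpa using add_le_add hp hq
  | monomial k a => simpa using Nat.mul_le_mul_left a (Nat.pow_le_pow_left h k)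

@[fun_prop]
theorem eval (q : Polynomial ℕ) (hf : PolyBounded f) : PolyBounded fun a => q.eval (f a) := by
  obtain ⟨p, hp⟩ := hf
  exact ⟨q.comp p, fun a => by simpa using monotone_eval_nat q (hp a)⟩

end PolyBounded

/-! ### Polynomial-time functions -/

open StackProg TreeProg TreeReg

/-- The program `p` replaces the element `a` on top of the main stack by `b` in at most `t` steps
and leaves the rest of the stacks as it is. -/
def Replaces (p : TreeProg) (a : α) (t : ℕ) (b : β) : Prop :=
  ∀ m s e c, RunWithin p (regs (treeTokens (code a) ++ m) s e c) t
    (regs (treeTokens (code b) ++ m) s e c)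

/-- `f` is computed in polynomial time by a program on trees. -/
@[fun_prop]
def PolyTime (f : α → β) : Prop :=
  ∃ (p : TreeProg) (q : Polynomial ℕ), ∀ a, codeSize (f a) ≤ q.eval (codeSize a) ∧
    Replaces p a (q.eval (codeSize a)) (f a)

namespace PolyTime

theorem of_replaces {f : α → β} (p : TreeProg) {t : α → ℕ}
    (hp : ∀ a, Replaces p a (t a) (f a)) (ht : PolyBounded t)
    (hs : PolyBounded fun a => codeSize (f a)) : PolyTime f := by
  obtain ⟨q, hq⟩ := hs.add ht
  exact ⟨p, q, fun a => ⟨le_self_add.trans (hq a), fun m s e c =>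
    (hp a m s e c).mono (le_add_self.trans (hq a))⟩⟩

theorem exists_replaces {f : α → β} (hf : PolyTime f) :
    ∃ (p : TreeProg) (q : Polynomial ℕ), ∀ a, Replaces p a (q.eval (codeSize a)) (f a) :=
  let ⟨p, q, h⟩ := hf
  ⟨p, q, fun a => (h a).2⟩

@[fun_prop]
theorem polyBounded_codeSize {f : α → β} (hf : PolyTime f) : PolyBounded fun a => codeSize (f a) :=
  let ⟨_, q, h⟩ := hf
  ⟨q, fun a => (h a).1⟩

theorem congr_code {f : α → β} {g : α → γ} (hf : PolyTime f) (h : ∀ a, code (g a) = code (f a)) :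
    PolyTime g := by
  obtain ⟨p, q, hp⟩ := hf
  refine ⟨p, q, fun a => ?_⟩
  simpa only [codeSize, Replaces, h] using hp a

@[fun_prop]
theorem id : PolyTime fun a : α => a :=
  of_replaces .skip (fun _ _ _ _ _ => .skip) (.const 1) (by fun_prop)

theorem encode : PolyTime fun a : α => code a := id.congr_code fun _ => rfl

@[fun_prop]
theorem const (b : β) : PolyTime fun _ : α => b :=
  of_replaces (.seq drop (pushList (treeTokens (code b))))
    (t := fun a => 10 * codeSize a + 7 + ((treeTokens (code b)).length + 1))
    (fun _ _ _ _ _ => .seq (drop_run ..) (pushList_run ..)) (by fun_prop) (by fun_prop)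

@[fun_prop]
theorem comp {g : β → γ} {f : α → β} (hg : PolyTime g) (hf : PolyTime f) :
    PolyTime fun a => g (f a) := by
  obtain ⟨p, q, hp⟩ := hf.exists_replaces
  obtain ⟨p', q', hp'⟩ := hg.exists_replaces
  obtain ⟨u, hu⟩ := hg.polyBounded_codeSize
  exact of_replaces (.seq p p')
    (t := fun a => q.eval (codeSize a) + q'.eval (codeSize (f a)))
    (fun _ _ _ _ _ => .seq (hp ..) (hp' ..)) (by fun_prop)
    (PolyBounded.mono (g := fun a => u.eval (codeSize (f a))) (by fun_prop) fun a => hu (f a))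

theorem of_code_comp {f : α → β} {g : BinaryTree Unit → BinaryTree Unit} (hg : PolyTime g)
    (h : ∀ a, g (code a) = code (f a)) : PolyTime f :=
  (hg.comp encode).congr_code fun a => (h a).symm

@[fun_prop]
theorem prodMk {f : α → β} {g : α → γ} (hf : PolyTime f) (hg : PolyTime g) :
    PolyTime fun a => (f a, g a) := by
  obtain ⟨p, q, hp⟩ := hf.exists_replaces
  obtain ⟨p', q', hp'⟩ := hg.exists_replaces
  refine of_replaces
    (.seq dup (.seq p (.seq stash (.seq p' (.seq (unstash B) (.push M .node))))))
    (t := fun a => (18 * codeSize a + 15) + (q.eval (codeSize a) + ((10 * codeSize (f a) + 8) +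
      (q'.eval (codeSize a) + ((4 * codeSize (f a) + 3) + 1))))) (fun a m s e c => ?_)
    (by fun_prop) (by simp only [codeSize_pair]; fun_prop)
  have := RunWithin.seq (dup_run (code a) m s e c) (.seq (hp ..) (.seq (stash_run ..)
    (.seq (hp' ..) (.seq (unstash_B_run ..) (push_M (a := .node))))))
  rwa [← List.append_assoc] at this

theorem codeSize_left_add_codeSize_right_le (x : BinaryTree Unit) :
    codeSize x.left + codeSize x.right ≤ codeSize x := by
  cases x with
  | nil => exact le_rfl
  | node _ l r => exact Nat.le_succ _

theorem left : PolyTime (BinaryTree.left : BinaryTree Unit → BinaryTree Unit) := by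
  refine of_replaces (.case M fun
      | some .node => .seq stash (.seq drop (unstash B))
      | some a => .push M a
      | none => .skip)
    (t := fun x => 24 * codeSize x + 19) (fun x m s e c => ?_) (by fun_prop)
    (PolyBounded.codeSize.mono fun x => le_self_add.trans (codeSize_left_add_codeSize_right_le x))
  cases x with
  | nil => exact (case_M push_M).mono (by omega)
  | node _ l r =>
    simp only [code, id_eq, treeTokens, List.cons_append, List.append_assoc]
    exact (case_M (.seq (stash_run ..) (.seq (drop_run ..) (unstash_B_run ..)))).mono
      (by simp only [codeSize, code, id_eq, BinaryTree.numNodes]; omega)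

theorem right : PolyTime (BinaryTree.right : BinaryTree Unit → BinaryTree Unit) := by
  refine of_replaces (.case M fun
      | some .node => drop
      | some a => .push M a
      | none => .skip)
    (t := fun x => 10 * codeSize x + 8) (fun x m s e c => ?_) (by fun_prop)
    (PolyBounded.codeSize.mono fun x => le_add_self.trans (codeSize_left_add_codeSize_right_le x))
  cases x with
  | nil => exact (case_M push_M).mono (by omega)
  | node _ l r =>
    simp only [code, id_eq, treeTokens, List.cons_append, List.append_assoc]
    exact (case_M (drop_run ..)).mono
      (by simp only [codeSize, code, id_eq, BinaryTree.numNodes]; omega)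

/-- Is the tree empty? -/
def isNilTree : BinaryTree Unit → Bool
  | .nil => true
  | .node .. => false

theorem isNilTree_polyTime : PolyTime isNilTree := by
  refine of_replaces (.case M fun
      | some .node => .seq drop (.seq drop (pushList (treeTokens (code false))))
      | _ => pushList (treeTokens (code true)))
    (t := fun x => 10 * codeSize x + 21) (fun x m s e c => ?_) (by fun_prop)
    ((PolyBounded.const 2).mono fun x => (codeSize_bool _).le)
  cases x with
  | nil => exact (case_M (pushList_run ..)).mono (by simp [code, treeTokens])
  | node _ l r =>
    simp only [code, id_eq, treeTokens, List.cons_append, List.append_assoc]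
    exact (case_M (.seq (drop_run ..) (.seq (drop_run ..) (pushList_run ..)))).mono
      (by simp only [codeSize, code, id_eq, BinaryTree.numNodes, List.length_cons,
        List.length_append, List.length_nil]; omega)

/-- The program that removes a truth value from the main stack and branches on it. -/
def branch (p p' : TreeProg) : TreeProg :=
  .case M fun _ => .case M fun
    | some .node => .seq drop (.seq drop (.seq drop p))
    | _ => .seq drop p'

theorem branch_run {p p' : TreeProg} {t : ℕ} {S : ∀ _, List TreeToken} {b : Bool}
    {m s e c : List TreeToken} (h : RunWithin (bif b then p else p') (regs m s e c) t S) :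
    RunWithin (branch p p') (regs (treeTokens (code b) ++ m) s e c) (23 + t) S := by
  cases b with
  | true =>
    exact (case_M (case_M (.seq (drop_run .nil ..) (.seq (drop_run .nil ..)
      (.seq (drop_run .nil ..) h))))).mono (by simp only [BinaryTree.numNodes]; omega)
  | false =>
    exact (case_M (case_M (.seq (drop_run (.node () .nil .nil) ..) h))).mono
      (by simp only [BinaryTree.numNodes]; omega)

@[fun_prop]
theorem cond {b : α → Bool} {f g : α → β} (hb : PolyTime b) (hf : PolyTime f) (hg : PolyTime g) :
    PolyTime fun a => bif b a then f a else g a := by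
  obtain ⟨p₀, q₀, hp₀⟩ := hb.exists_replaces
  obtain ⟨p, q, hp⟩ := hf.exists_replaces
  obtain ⟨p', q', hp'⟩ := hg.exists_replaces
  refine of_replaces (.seq dup (.seq p₀ (branch p p')))
    (t := fun a => (18 * codeSize a + 15) + (q₀.eval (codeSize a) + (23 + (q.eval (codeSize a) +
      q'.eval (codeSize a))))) (fun a m s e c => ?_) (by fun_prop)
    (PolyBounded.mono (g := fun a => codeSize (f a) + codeSize (g a)) (by fun_prop) fun a => ?_)
  · refine .seq (dup_run (code a) m s e c) (.seq (hp₀ ..) (branch_run ?_))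
    cases b a with
    | true => exact (hp a m s e c).mono le_self_add
    | false => exact (hp' a m s e c).mono le_add_self
  · cases b a <;> simp

section Iterate

/-- The program that removes a list from the main stack and pushes one symbol to the counter for
each entry of the list. -/
def countLoop : TreeProg := .loop M (· == some .node) fun _ => .seq drop (.push C .node)

theorem countLoop_run (l : List α) (m s e c : List TreeToken) :
    RunWithin countLoop (regs (treeTokens (code l) ++ m) s e c) (10 * codeSize l + 1)
      (regs m s e (List.replicate l.length .node ++ c)) := by
  induction l generalizing c with
  | nil => exact (loop_exit_M rfl).mono (by omega)
  | cons a l ih =>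
    rw [List.length_cons, List.replicate_succ', List.append_assoc]
    simp only [code, TreeCode.codeList, treeTokens, List.cons_append, List.append_assoc]
    exact (loop_step_M rfl (.seq (drop_run ..) push_C) (ih (.node :: c))).mono
      (by simp only [codeSize_cons]; simp only [codeSize, code]; omega)

/-- The program that runs `p` once for each symbol on the counter. -/
def repeatLoop (p : TreeProg) : TreeProg := .loop C (· == some .node) fun _ => p

theorem repeatLoop_run {p : TreeProg} {step : γ → γ} {n T : ℕ} {x : γ}
    (hp : ∀ i < n, Replaces p (step^[i] x) T (step^[i + 1] x)) (m s e c : List TreeToken) :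
    RunWithin (repeatLoop p)
      (regs (treeTokens (code x) ++ m) s e (List.replicate n .node ++ .mark :: c))
      ((1 + T) * n + 1) (regs (treeTokens (code (step^[n] x)) ++ m) s e c) := by
  induction n generalizing x with
  | zero => exact (loop_exit_C rfl).mono (by omega)
  | succ n ih =>
    have rest := ih (x := step x) fun i hi => hp (i + 1) (by omega)
    exact (loop_step_C rfl (hp 0 n.succ_pos m s e _) rest).mono (by rw [Nat.mul_add]; omega)

theorem iterate {l : α → List β} {x : α → γ} {step : γ → γ} {bound : α → ℕ} (hl : PolyTime l)
    (hx : PolyTime x) (hstep : PolyTime step) (hbound : PolyBounded bound)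
    (hle : ∀ a, ∀ i ≤ (l a).length, codeSize (step^[i] (x a)) ≤ bound a) :
    PolyTime fun a => step^[(l a).length] (x a) := by
  obtain ⟨p₀, q₀, hp₀⟩ := (hl.prodMk hx).exists_replaces
  obtain ⟨p, q, hp⟩ := hstep.exists_replaces
  refine of_replaces (.seq p₀ (.case M fun _ =>
      .seq (.push C .mark) (.seq countLoop (repeatLoop p))))
    (t := fun a => q₀.eval (codeSize a) + (1 + (1 + ((10 * codeSize (l a) + 1) +
      ((1 + q.eval (bound a)) * codeSize (l a) + 1)))))
    (fun a m s e c => ?_) (by fun_prop) (hbound.mono fun a => hle a _ le_rfl)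
  have args := hp₀ a m s e c
  simp only [code, treeTokens, List.cons_append, List.append_assoc] at args
  have steps : ∀ i < (l a).length,
      Replaces p (step^[i] (x a)) (q.eval (bound a)) (step^[i + 1] (x a)) := by
    intro i hi m s e c
    rw [Function.iterate_succ_apply']
    exact (hp _ m s e c).mono (monotone_eval_nat q (hle a i hi.le))
  exact (RunWithin.seq args (case_M (.seq push_C (.seq (countLoop_run ..)
    (repeatLoop_run steps ..))))).mono (by have := length_le_codeSize (l a); gcongr)

end Iterate

end PolyTime

section CodeSize

theorem codeSize_append (l l' : List α) : codeSize (l ++ l') = codeSize l + codeSize l' := by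
  induction l with
  | nil => rw [codeSize_nil, List.nil_append, zero_add]
  | cons a l ih => rw [List.cons_append, codeSize_cons, codeSize_cons]; omega

theorem codeSize_lt_of_mem {a : α} {l : List α} (h : a ∈ l) : codeSize a < codeSize l := by
  obtain ⟨s, t, rfl⟩ := List.append_of_mem h
  rw [codeSize_append, codeSize_cons]
  omega

theorem codeSize_headD_add_tail_le (l : List α) (d : α) :
    codeSize (l.headD d) + codeSize l.tail ≤ codeSize l + codeSize d := by
  cases l with
  | nil => rw [List.tail_nil, List.headD_nil, add_comm]
  | cons a l => rw [List.tail_cons, List.headD_cons, codeSize_cons]; omega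

end CodeSize

theorem PolyBounded.exists_forall_mem_le {f : α → List β} {u : α × β → ℕ}
    (hf : PolyTime f) (hu : PolyBounded u) :
    ∃ K : α → ℕ, PolyBounded K ∧ ∀ a, ∀ b ∈ f a, u (a, b) ≤ K a := by
  obtain ⟨q, hq⟩ := hu
  refine ⟨fun a => q.eval (_root_.codeSize a + _root_.codeSize (f a)), by fun_prop, fun a b hb =>
    (hq _).trans (monotone_eval_nat q ?_)⟩
  have := codeSize_lt_of_mem hb
  rw [codeSize_pair]
  omega

namespace PolyTime

section Basic

variable {f : α → β} {l : α → List β}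

@[fun_prop]
theorem fst {f : α → β × γ} (hf : PolyTime f) : PolyTime fun a => (f a).1 :=
  comp (of_code_comp left fun _ => rfl : PolyTime (Prod.fst : β × γ → β)) hf

@[fun_prop]
theorem snd {f : α → β × γ} (hf : PolyTime f) : PolyTime fun a => (f a).2 :=
  comp (of_code_comp right fun _ => rfl : PolyTime (Prod.snd : β × γ → γ)) hf

@[fun_prop]
theorem cons (hf : PolyTime f) (hl : PolyTime l) : PolyTime fun a => f a :: l a :=
  (hf.prodMk hl).congr_code fun _ => rfl

@[fun_prop]
theorem tail (hl : PolyTime l) : PolyTime fun a => (l a).tail :=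
  comp (of_code_comp right (by rintro (_ | _) <;> rfl) : PolyTime (List.tail : List β → _)) hl

@[fun_prop]
theorem isEmpty (hl : PolyTime l) : PolyTime fun a => (l a).isEmpty := by
  have h : PolyTime fun a => isNilTree (code (l a)) := isNilTree_polyTime.comp (encode.comp hl)
  convert h using 2 with a
  cases l a <;> rfl

@[fun_prop]
theorem headD (hl : PolyTime l) (hf : PolyTime f) : PolyTime fun a => (l a).headD (f a) := by
  have h : PolyTime fun a => bif (l a).isEmpty then code (f a) else (code (l a)).left :=
    hl.isEmpty.cond (encode.comp hf) (left.comp (encode.comp hl))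
  refine h.congr_code fun a => ?_
  cases l a <;> rfl

end Basic

section Finite

/-- Equality of trees, by recursion on the first one. -/
def treeEq : BinaryTree Unit → BinaryTree Unit → Bool
  | .nil, x => isNilTree x
  | .node _ l r, x => bif isNilTree x then false else
      bif treeEq l x.left then treeEq r x.right else false

theorem treeEq_eq_true_iff (d x : BinaryTree Unit) : treeEq d x = true ↔ x = d := by
  induction d generalizing x with
  | nil => cases x <;> simp [treeEq, isNilTree]
  | node _ l r hl hr =>
    cases x with
    | nil => simp [treeEq, isNilTree]
    | node _ l' r' => cases h : treeEq l l' <;> simp [treeEq, isNilTree, ← hl, ← hr, h]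

theorem treeEq_polyTime (d : BinaryTree Unit) : PolyTime (treeEq d) := by
  induction d with
  | nil => exact isNilTree_polyTime
  | node _ l r hl hr =>
    exact isNilTree_polyTime.cond (const false) ((hl.comp left).cond (hr.comp right) (const false))

theorem decide_eq_const {f : α → β} (hf : PolyTime f) (c : β) [DecidableEq β] :
    PolyTime fun a => decide (f a = c) := by
  have h : PolyTime fun a => treeEq (code c) (code (f a)) :=
    (treeEq_polyTime _).comp (encode.comp hf)
  convert h using 2 with a
  rw [Bool.eq_iff_iff, decide_eq_true_iff, treeEq_eq_true_iff, code_injective.eq_iff]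

theorem cases_mem_list {f : α → β} {F : β → α → γ} {d : α → γ} [DecidableEq β] (hf : PolyTime f)
    (keys : List β) (hF : ∀ c, PolyTime (F c)) (hd : PolyTime d) :
    PolyTime fun a => if f a ∈ keys then F (f a) a else d a := by
  induction keys with
  | nil => simpa using hd
  | cons c keys ih =>
    convert (hf.decide_eq_const c).cond (hF c) ih using 2 with a
    by_cases h : f a = c <;> simp [h]

/-- The fixed programs for the finitely many values in `s` are selected by comparing `f a` with
each of them. -/
theorem cases_mem_finite {f : α → β} {F : β → α → γ} {d : α → γ} {s : β → Prop} [DecidablePred s]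
    (hf : PolyTime f) (hs : {b | s b}.Finite) (hF : ∀ c, PolyTime (F c)) (hd : PolyTime d) :
    PolyTime fun a => if s (f a) then F (f a) a else d a := by
  classical
  simpa using cases_mem_list hf hs.toFinset.toList hF hd

theorem cases_finite [Finite β] {f : α → β} {F : β → α → γ} (hf : PolyTime f)
    (hF : ∀ c, PolyTime (F c)) : PolyTime fun a => F (f a) a := by
  rcases isEmpty_or_nonempty β with h | ⟨⟨c⟩⟩
  · exact ⟨.skip, 0, fun a => h.elim (f a)⟩
  · simpa using cases_mem_finite (s := fun _ => True) hf (Set.toFinite _) hF (hF c)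

theorem of_finite [Finite α] (f : α → β) : PolyTime f :=
  cases_finite (F := fun a _ => f a) id fun _ => const _

end Finite

@[fun_prop]
theorem not {b : α → Bool} (hb : PolyTime b) : PolyTime fun a => !b a :=
  (of_finite Bool.not).comp hb

@[fun_prop]
theorem and {b c : α → Bool} (hb : PolyTime b) (hc : PolyTime c) : PolyTime fun a => b a && c a :=
  comp (of_finite fun p : Bool × Bool => p.1 && p.2) (hb.prodMk hc)

section Lists

variable {l : α → List β}

theorem foldl_of_bound {z : α → γ} {s : α → γ → β → γ} {K : α → ℕ} (hl : PolyTime l)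
    (hz : PolyTime z) (hs : PolyTime fun p : α × γ × β => s p.1 p.2.1 p.2.2) (hK : PolyBounded K)
    (hle : ∀ a l', l' <+: l a → codeSize (l'.foldl (s a) (z a)) ≤ K a) :
    PolyTime fun a => (l a).foldl (s a) (z a) := by
  rcases isEmpty_or_nonempty β with h | ⟨⟨d⟩⟩
  · simpa only [Subsingleton.elim (l _) [], List.foldl_nil] using hz
  let step : List β × α × γ → List β × α × γ := fun x =>
    (x.1.tail, x.2.1, s x.2.1 x.2.2 (x.1.headD d))
  have step_polyTime : PolyTime step :=
    prodMk (by fun_prop) (prodMk (by fun_prop)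
      (comp (f := fun x : List β × α × γ => (x.2.1, x.2.2, x.1.headD d)) hs (by fun_prop)))
  have step_iterate (a : α) (i : ℕ) (l : List β) (g : γ) (hi : i ≤ l.length) :
      step^[i] (l, a, g) = (l.drop i, a, (l.take i).foldl (s a) g) := by
    induction i generalizing l g with
    | zero => simp
    | succ i ih =>
      obtain _ | ⟨b, l⟩ := l
      · simp at hi
      · simpa [step] using ih l (s a g b) (by simpa using hi)
  have h := iterate (x := fun a => (l a, a, z a))
    (bound := fun a => codeSize (l a) + (codeSize a + K a + 1) + 1) hl (by fun_prop) step_polyTime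
    (by fun_prop) fun a i hi => by
      have h₁ := hle a _ (List.take_prefix i (l a))
      have h₂ := codeSize_append ((l a).take i) ((l a).drop i)
      rw [List.take_append_drop] at h₂
      rw [step_iterate a i _ _ hi, codeSize_pair, codeSize_pair]
      omega
  simpa only [step_iterate _ _ _ _ le_rfl, List.take_length] using h.snd.snd

theorem foldl {z : α → γ} {s : α → γ → β → γ} {K : α → ℕ} (hl : PolyTime l) (hz : PolyTime z)
    (hs : PolyTime fun p : α × γ × β => s p.1 p.2.1 p.2.2) (hK : PolyBounded K)
    (hle : ∀ a g, ∀ b ∈ l a, codeSize (s a g b) ≤ codeSize g + K a) :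
    PolyTime fun a => (l a).foldl (s a) (z a) := by
  refine foldl_of_bound (K := fun a => codeSize (z a) + K a * codeSize (l a)) hl hz hs
    (by fun_prop) fun a l' hl' => ?_
  have codeSize_foldl_le : codeSize (l'.foldl (s a) (z a)) ≤ codeSize (z a) + K a * l'.length := by
    have hmem : ∀ b ∈ l', b ∈ l a := fun b hb => hl'.subset hb
    clear hl'
    induction l' using List.reverseRecOn with
    | nil => simp
    | append_singleton l' b ih =>
      have h₁ := ih fun b hb => hmem b (List.mem_append_left _ hb)
      have h₂ := hle a (l'.foldl (s a) (z a)) b (hmem b (by simp))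
      rw [List.foldl_append, List.length_append, List.length_singleton, Nat.mul_succ]
      exact h₂.trans (by omega)
  exact codeSize_foldl_le.trans <| Nat.add_le_add_left (Nat.mul_le_mul_left _
    (hl'.length_le.trans (length_le_codeSize _))) _

@[fun_prop]
theorem reverse (hl : PolyTime l) : PolyTime fun a => (l a).reverse := by
  simpa only [List.foldl_flip_cons_eq_append, List.append_nil,
    List.map_id'] using foldl (z := fun _ => [])
      (s := fun _ g b => b :: g) (K := fun a => codeSize (l a)) hl (const _) (by fun_prop)
      (by fun_prop) fun a g b hb => by
      have := codeSize_lt_of_mem hb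
      rw [codeSize_cons]
      omega

theorem foldr {z : α → γ} {s : α → β → γ → γ} {K : α → ℕ} (hl : PolyTime l) (hz : PolyTime z)
    (hs : PolyTime fun p : α × β × γ => s p.1 p.2.1 p.2.2) (hK : PolyBounded K)
    (hle : ∀ a g, ∀ b ∈ l a, codeSize (s a b g) ≤ codeSize g + K a) :
    PolyTime fun a => (l a).foldr (s a) (z a) := by
  simpa only [List.foldl_reverse] using foldl (s := fun a g b => s a b g) hl.reverse hz
    (comp (f := fun p : α × γ × β => (p.1, p.2.2, p.2.1)) hs (by fun_prop)) hK
    fun a g b hb => hle a g b (List.mem_reverse.1 hb)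

@[fun_prop]
theorem append {l' : α → List β} (hl : PolyTime l) (hl' : PolyTime l') :
    PolyTime fun a => l a ++ l' a := by
  simpa only [List.foldr_cons_eq_append'] using
    foldr (s := fun _ b l => b :: l) (K := fun a => codeSize (l a)) hl hl' (by fun_prop)
      (by fun_prop) fun a g b hb => by
      have := codeSize_lt_of_mem hb
      rw [codeSize_cons]
      omega

@[fun_prop]
theorem flatMap {g : α → β → List γ} (hl : PolyTime l) (hg : PolyTime fun p : α × β => g p.1 p.2) :
    PolyTime fun a => (l a).flatMap (g a) := by
  obtain ⟨K, hK, hle⟩ := PolyBounded.exists_forall_mem_le hl hg.polyBounded_codeSize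
  have h := foldr (s := fun a b l => g a b ++ l) hl (const []) (append
    (comp (f := fun p : α × β × List γ => (p.1, p.2.1)) hg (by fun_prop)) (by fun_prop)) hK
    fun a l b hb => by rw [codeSize_append, add_comm]; exact Nat.add_le_add_left (hle a b hb) _
  convert h using 2 with a
  induction l a with
  | nil => rfl
  | cons b l ih => rw [List.flatMap_cons, ih, List.foldr_cons]

@[fun_prop]
theorem map {g : α → β → γ} (hl : PolyTime l) (hg : PolyTime fun p : α × β => g p.1 p.2) :
    PolyTime fun a => (l a).map (g a) := by
  simpa only [List.flatMap_pure_eq_map, List.map_eq_flatMap] using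
    hl.flatMap (g := fun a b => [g a b]) (hg.cons (const []))

@[fun_prop]
theorem filter {g : α → β → Bool} (hl : PolyTime l) (hg : PolyTime fun p : α × β => g p.1 p.2) :
    PolyTime fun a => (l a).filter (g a) := by
  convert hl.flatMap (g := fun a b => bif g a b then [b] else [])
    (hg.cond (snd id |>.cons (const [])) (const [])) using 2 with a
  induction l a with
  | nil => rfl
  | cons b l ih => cases h : g a b <;> simp [h, ih]

@[fun_prop]
theorem any {g : α → β → Bool} (hl : PolyTime l) (hg : PolyTime fun p : α × β => g p.1 p.2) :
    PolyTime fun a => (l a).any (g a) := by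
  convert (hl.filter hg).isEmpty.not using 2 with a
  induction l a with
  | nil => rfl
  | cons b l ih => cases h : g a b <;> simp [h, ih]

@[fun_prop]
theorem all {g : α → β → Bool} (hl : PolyTime l) (hg : PolyTime fun p : α × β => g p.1 p.2) :
    PolyTime fun a => (l a).all (g a) := by
  simpa only [List.not_any_eq_all_not, Bool.not_not] using
    (hl.any (g := fun a b => !g a b) hg.not).not

end Lists

end PolyTime

/-! ### Binary arithmetic -/

/-- The natural number with the given binary digits, least significant digit first. -/
def natOfBits (l : List Bool) : ℕ := l.foldr Nat.bit 0

theorem natOfBits_nil : natOfBits [] = 0 := rfl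

theorem natOfBits_cons (b : Bool) (l : List Bool) :
    natOfBits (b :: l) = Nat.bit b (natOfBits l) := rfl

theorem natOfBits_bits (n : ℕ) : natOfBits n.bits = n := by
  induction n using Nat.binaryRec' with
  | zero => rfl
  | bit b n hn ih => rw [Nat.bits_append_bit n b hn, natOfBits_cons, ih]

instance : TreeCode ℕ where
  code n := code n.bits
  code_injective m n h := by
    rw [← natOfBits_bits m, ← natOfBits_bits n, code_injective h]

theorem codeSize_bits (n : ℕ) : codeSize n.bits = codeSize n := rfl

theorem codeSize_list_bool (l : List Bool) : codeSize l = 3 * l.length := by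
  induction l with
  | nil => rfl
  | cons b l ih => rw [codeSize_cons, ih, codeSize_bool, List.length_cons]; omega

theorem codeSize_nat (n : ℕ) : codeSize n = 3 * n.size := by
  rw [← Nat.size_eq_bits_len, ← codeSize_list_bool, codeSize_bits]

theorem codeSize_bit_le (b : Bool) (n : ℕ) : codeSize (Nat.bit b n) ≤ codeSize n + 3 := by
  rw [codeSize_nat, codeSize_nat]
  by_cases h : Nat.bit b n = 0
  · simp [h]
  · rw [Nat.size_bit h]; omega

theorem codeSize_natOfBits_le (l : List Bool) : codeSize (natOfBits l) ≤ codeSize l := by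
  induction l with
  | nil => rfl
  | cons b l ih =>
    have := codeSize_bit_le b (natOfBits l)
    rw [codeSize_cons, codeSize_bool]
    exact this.trans (by omega)

theorem codeSize_add_le (m n : ℕ) : codeSize (m + n) ≤ codeSize m + codeSize n + 3 := by
  have h : (m + n).size ≤ m.size + n.size + 1 := by
    rw [Nat.size_le, pow_succ, pow_add]
    nlinarith [Nat.lt_size_self m, Nat.lt_size_self n, Nat.one_le_two_pow (n := m.size),
      Nat.one_le_two_pow (n := n.size)]
  simp only [codeSize_nat]
  omega

namespace PolyTime

section Binary

@[fun_prop]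
theorem bits {f : α → ℕ} (hf : PolyTime f) : PolyTime fun a => (f a).bits :=
  hf.congr_code fun _ => rfl

theorem of_bits {f : α → ℕ} (hf : PolyTime fun a => (f a).bits) : PolyTime f :=
  hf.congr_code fun _ => rfl

@[fun_prop]
theorem bodd {f : α → ℕ} (hf : PolyTime f) : PolyTime fun a => (f a).bodd := by
  convert hf.bits.headD (const false) using 2 with a
  cases f a using Nat.binaryRec' with
  | zero => rfl
  | bit b n hn => rw [Nat.bits_append_bit n b hn, Nat.bodd_bit, List.headD_cons]

@[fun_prop]
theorem div2 {f : α → ℕ} (hf : PolyTime f) : PolyTime fun a => (f a).div2 := by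
  refine of_bits ?_
  convert hf.bits.tail using 2 with a
  cases f a using Nat.binaryRec' with
  | zero => rfl
  | bit b n hn => rw [Nat.bits_append_bit n b hn, Nat.div2_bit, List.tail_cons]

@[fun_prop]
theorem bit {b : α → Bool} {f : α → ℕ} (hb : PolyTime b) (hf : PolyTime f) :
    PolyTime fun a => Nat.bit (b a) (f a) := by
  have h : PolyTime fun a => bif !b a && (f a).bits.isEmpty then [] else b a :: (f a).bits := by
    fun_prop
  refine of_bits ?_
  convert h using 2 with a
  obtain hfa | hfa := eq_or_ne (f a) 0
  · rw [hfa]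
    cases b a <;> rfl
  · have : (f a).bits ≠ [] := fun h => hfa <| by rw [← natOfBits_bits (f a), h]; rfl
    rw [Nat.bits_append_bit _ _ fun h => absurd h hfa, List.isEmpty_eq_false_iff.mpr this,
      Bool.and_false, cond_false]

@[fun_prop]
theorem natOfBits {l : α → List Bool} (hl : PolyTime l) :
    PolyTime fun a => natOfBits (l a) :=
  hl.foldr (s := fun _ b n => Nat.bit b n) (K := fun _ => 3) (const 0) (by fun_prop)
    (by fun_prop) fun _ n b _ => codeSize_bit_le b n

end Binary

end PolyTime

section SerialArithmetic

/-- A step of digit-serial arithmetic. The state consists of the carry, the remaining digits of the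
operands, and the digits of the result, most significant digit first; `δ` computes the next carry
and the next digit of the result. -/
def serialStep (δ : Bool × Bool × Bool → Bool × Bool) (s : Bool × ℕ × ℕ × List Bool) :
    Bool × ℕ × ℕ × List Bool :=
  ((δ (s.1, s.2.1.bodd, s.2.2.1.bodd)).1, s.2.1.div2, s.2.2.1.div2,
    (δ (s.1, s.2.1.bodd, s.2.2.1.bodd)).2 :: s.2.2.2)

/-- The final carry of digit-serial arithmetic with `m` and `n`, and the digits of the result. -/
def serial (δ : Bool × Bool × Bool → Bool × Bool) (m n : ℕ) : Bool × List Bool :=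
  let s := (serialStep δ)^[m.size + n.size] (false, m, n, [])
  (s.1, s.2.2.2)

theorem serialStep_iterate_operands (δ : Bool × Bool × Bool → Bool × Bool) (i m n : ℕ) :
    ((serialStep δ)^[i] (false, m, n, [])).2.1 = m / 2 ^ i ∧
      ((serialStep δ)^[i] (false, m, n, [])).2.2.1 = n / 2 ^ i := by
  induction i with
  | zero => simp
  | succ i ih =>
    rw [Function.iterate_succ_apply', serialStep, ih.1, ih.2, Nat.div2_val, Nat.div2_val,
      Nat.div_div_eq_div_mul, Nat.div_div_eq_div_mul, pow_succ]
    exact ⟨rfl, rfl⟩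

/-- For `σ = 1` the hypothesis describes a full adder, for `σ = -1` a full subtractor. -/
theorem horner_serial {σ : ℤ} {δ : Bool × Bool × Bool → Bool × Bool}
    (hδ : ∀ c x y, (x.toNat + σ * (y.toNat + c.toNat) : ℤ) =
      2 * (σ * (δ (c, x, y)).1.toNat) + (δ (c, x, y)).2.toNat) (m n : ℕ) :
    (serial δ m n).2.foldl (fun (z : ℤ) d => 2 * z + d.toNat) (σ * (serial δ m n).1.toNat) =
      m + σ * n := by
  have invariant (i : ℕ) (s : Bool × ℕ × ℕ × List Bool) :
      ((serialStep δ)^[i] s).2.2.2.foldl (fun (z : ℤ) d => 2 * z + d.toNat)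
        (((serialStep δ)^[i] s).2.1 +
          σ * (((serialStep δ)^[i] s).2.2.1 + ((serialStep δ)^[i] s).1.toNat)) =
      s.2.2.2.foldl (fun (z : ℤ) d => 2 * z + d.toNat) (s.2.1 + σ * (s.2.2.1 + s.1.toNat)) := by
    induction i generalizing s with
    | zero => rfl
    | succ i ih =>
      obtain ⟨c, m, n, out⟩ := s
      rw [Function.iterate_succ_apply, ih]
      simp only [serialStep, List.foldl_cons]
      congr 1
      have hm : (m : ℤ) = m.bodd.toNat + 2 * m.div2 := by exact_mod_cast (Nat.bodd_add_div2 m).symm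
      have hn : (n : ℤ) = n.bodd.toNat + 2 * n.div2 := by exact_mod_cast (Nat.bodd_add_div2 n).symm
      linear_combination -hδ c m.bodd n.bodd - hm - σ * hn
  have h := invariant (m.size + n.size) (false, m, n, [])
  obtain ⟨hm, hn⟩ := serialStep_iterate_operands δ (m.size + n.size) m n
  rw [hm, hn, Nat.div_eq_of_lt ((Nat.lt_size_self m).trans_le (Nat.pow_le_pow_right two_pos
    le_self_add)), Nat.div_eq_of_lt ((Nat.lt_size_self n).trans_le (Nat.pow_le_pow_right two_pos
    le_add_self))] at h
  simpa [serial] using h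

theorem cast_foldl_bit (l : List Bool) (n : ℕ) :
    ((l.foldl (fun n d => Nat.bit d n) n : ℕ) : ℤ) =
      l.foldl (fun (z : ℤ) d => 2 * z + d.toNat) n := by
  induction l generalizing n with
  | nil => rfl
  | cons b l ih => rw [List.foldl_cons, List.foldl_cons, ih, Nat.bit_val]; push_cast; rfl

theorem horner_neg {z : ℤ} (hz : z < 0) (l : List Bool) :
    l.foldl (fun (z : ℤ) d => 2 * z + d.toNat) z < 0 := by
  induction l generalizing z with
  | nil => exact hz
  | cons b _ ih =>
    refine ih ?_
    have := b.toNat_le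
    dsimp only
    omega

/-- A full adder. -/
def fullAdder : Bool × Bool × Bool → Bool × Bool
  | (c, x, y) => (bif x then y || c else y && c, x ^^ (y ^^ c))

/-- A full subtractor. -/
def fullSubtractor : Bool × Bool × Bool → Bool × Bool
  | (c, x, y) => (bif x then y && c else y || c, x ^^ (y ^^ c))

theorem add_eq_foldl_serial (m n : ℕ) : m + n = (serial fullAdder m n).2.foldl
    (fun n d => Nat.bit d n) (serial fullAdder m n).1.toNat := by
  have h := horner_serial (σ := 1) (δ := fullAdder)
    (by rintro (_ | _) (_ | _) (_ | _) <;> rfl) m n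
  rw [one_mul, one_mul, ← cast_foldl_bit] at h
  exact_mod_cast h.symm

theorem sub_eq_foldl_serial (m n : ℕ) : m - n = bif (serial fullSubtractor m n).1 then 0 else
    (serial fullSubtractor m n).2.foldl (fun n d => Nat.bit d n) 0 := by
  have h := horner_serial (σ := -1) (δ := fullSubtractor)
    (by rintro (_ | _) (_ | _) (_ | _) <;> rfl) m n
  cases hc : (serial fullSubtractor m n).1 with
  | true =>
    have := horner_neg (z := -1) (by norm_num) (serial fullSubtractor m n).2
    simp only [hc, Bool.toNat_true, Nat.cast_one, mul_one] at h
    rw [cond_true]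
    omega
  | false =>
    simp only [hc, Bool.toNat_false, Nat.cast_zero, mul_zero] at h
    rw [← Nat.cast_zero, ← cast_foldl_bit] at h
    rw [cond_false]
    omega

end SerialArithmetic

namespace PolyTime

@[fun_prop]
theorem serial {m n : α → ℕ} (δ : Bool × Bool × Bool → Bool × Bool) (hm : PolyTime m)
    (hn : PolyTime n) : PolyTime fun a => serial δ (m a) (n a) := by
  have hstep : PolyTime (serialStep δ) := by
    have : PolyTime δ := of_finite δ
    unfold serialStep
    fun_prop
  have h := foldl (l := fun a => (m a).bits ++ (n a).bits) (K := fun _ => 3)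
    (z := fun a => (false, m a, n a, ([] : List Bool))) (s := fun _ s _ => serialStep δ s)
    (by fun_prop) (by fun_prop) (by fun_prop) (by fun_prop) fun _ s _ _ => by
      have hdiv (n : ℕ) : codeSize n.div2 ≤ codeSize n := by
        rw [codeSize_nat, codeSize_nat, Nat.div2_val]
        exact Nat.mul_le_mul_left 3 (Nat.size_le_size (Nat.div_le_self n 2))
      obtain ⟨c, m, n, out⟩ := s
      simp only [serialStep, codeSize_pair, codeSize_cons, codeSize_bool]
      linarith [hdiv m, hdiv n]
  simp only [List.foldl_const, List.length_append, Nat.size_eq_bits_len] at h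
  exact h.fst.prodMk h.snd.snd.snd

variable {f g : α → ℕ}

@[fun_prop]
theorem toNat {b : α → Bool} (hb : PolyTime b) : PolyTime fun a => (b a).toNat :=
  (of_finite Bool.toNat).comp hb

@[fun_prop]
theorem foldl_bit {l : α → List Bool} (hl : PolyTime l) (hf : PolyTime f) :
    PolyTime fun a => (l a).foldl (fun n d => Nat.bit d n) (f a) :=
  hl.foldl (s := fun _ n d => Nat.bit d n) (K := fun _ => 3) hf (by fun_prop) (by fun_prop)
    fun _ n d _ => codeSize_bit_le d n

@[fun_prop]
theorem add (hf : PolyTime f) (hg : PolyTime g) : PolyTime fun a => f a + g a := by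
  simp_rw [add_eq_foldl_serial]
  fun_prop

@[fun_prop]
theorem sub (hf : PolyTime f) (hg : PolyTime g) : PolyTime fun a => f a - g a := by
  simp_rw [sub_eq_foldl_serial]
  fun_prop

@[fun_prop]
theorem ble (hf : PolyTime f) (hg : PolyTime g) : PolyTime fun a => (f a).ble (g a) := by
  have h : PolyTime fun a => (f a - g a).bits.isEmpty := by fun_prop
  convert h using 2 with a
  rw [Bool.eq_iff_iff, Nat.ble_eq, List.isEmpty_iff, ← List.length_eq_zero_iff,
    Nat.size_eq_bits_len, Nat.size_eq_zero, Nat.sub_eq_zero_iff_le]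

@[fun_prop]
theorem decide_le (hf : PolyTime f) (hg : PolyTime g) : PolyTime fun a => decide (f a ≤ g a) := by
  have h : PolyTime fun a => (f a).ble (g a) := by fun_prop
  convert h using 2 with a
  rw [Bool.eq_iff_iff, Nat.ble_eq, decide_eq_true_iff]

@[fun_prop]
theorem decide_lt (hf : PolyTime f) (hg : PolyTime g) : PolyTime fun a => decide (f a < g a) :=
  (hf.add (const 1)).decide_le hg

@[fun_prop]
theorem beq_nat (hf : PolyTime f) (hg : PolyTime g) : PolyTime fun a => f a == g a := by
  have h : PolyTime fun a => decide (f a ≤ g a) && decide (g a ≤ f a) := by fun_prop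
  convert h using 2 with a
  rw [Bool.eq_iff_iff, beq_iff_eq, Bool.and_eq_true, decide_eq_true_iff, decide_eq_true_iff,
    le_antisymm_iff]

@[fun_prop]
theorem mul (hf : PolyTime f) (hg : PolyTime g) : PolyTime fun a => f a * g a := by
  have h : PolyTime fun a =>
      (f a).bits.foldr (fun b n => bif b then g a + Nat.bit false n else Nat.bit false n) 0 :=
    hf.bits.foldr (K := fun a => codeSize (g a) + 6)
      (s := fun a b n => bif b then g a + Nat.bit false n else Nat.bit false n)
      (const 0) (by fun_prop) (by fun_prop) fun a n b _ => by
        have := codeSize_add_le (g a) (Nat.bit false n)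
        have := codeSize_bit_le false n
        cases b <;> simp only [cond_true, cond_false] <;> omega
  convert h using 2 with a
  have horner (l : List Bool) :
      l.foldr (fun b n => bif b then g a + Nat.bit false n else Nat.bit false n) 0 =
        _root_.natOfBits l * g a := by
    induction l with
    | nil => rw [List.foldr_nil, natOfBits_nil, Nat.zero_mul]
    | cons b l ih =>
      rw [List.foldr_cons, ih, natOfBits_cons]
      cases b <;> simp only [cond_true, cond_false, Nat.bit_false, Nat.bit_true] <;> ring
  rw [horner, natOfBits_bits]

section ListNat

variable {l : α → List ℕ}

@[fun_prop]
theorem sum (hl : PolyTime l) : PolyTime fun a => (l a).sum :=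
  hl.foldr (s := fun _ m n => m + n) (K := fun a => codeSize (l a) + 3) (const 0) (by fun_prop)
    (by fun_prop) fun a n m hm => by
      have := codeSize_add_le m n
      have := codeSize_lt_of_mem hm
      omega

@[fun_prop]
theorem length {l : α → List β} (hl : PolyTime l) : PolyTime fun a => (l a).length := by
  have h : PolyTime fun a => ((l a).map fun _ => 1).sum := by fun_prop
  simpa using h

@[fun_prop]
theorem elem (hf : PolyTime f) (hl : PolyTime l) : PolyTime fun a => (l a).elem (f a) := by
  have h : PolyTime fun a => (l a).any (f a == ·) := by fun_prop
  simpa only [List.any_beq] using h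

@[fun_prop]
theorem idxOf (hf : PolyTime f) (hl : PolyTime l) : PolyTime fun a => (l a).idxOf (f a) := by
  have h : PolyTime fun a => (l a).foldr (fun m n => bif m == f a then 0 else n + 1) 0 :=
    hl.foldr (K := fun _ => 6) (s := fun a m n => bif m == f a then 0 else n + 1) (const 0)
      (by fun_prop) (by fun_prop) fun a n m _ => by
        have := codeSize_add_le n 1
        have : codeSize 1 = 3 := rfl
        cases m == f a
        · rw [cond_false]; omega
        · exact Nat.zero_le _
  convert h using 2 with a
  induction l a with
  | nil => rfl
  | cons m l ih => rw [List.idxOf_cons, ih, List.foldr_cons]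

theorem pwFilter {R : β → β → Prop} [DecidableRel R] {l : α → List β} (hl : PolyTime l)
    (hR : PolyTime fun p : β × β => decide (R p.1 p.2)) :
    PolyTime fun a => (l a).pwFilter R := by
  have hR' : PolyTime fun p : (α × β × List β) × β => decide (R p.1.2.1 p.2) :=
    hR.comp (f := fun p : (α × β × List β) × β => (p.1.2.1, p.2)) (by fun_prop)
  have h : PolyTime fun a => (l a).foldr
      (fun b L => bif L.all fun c => decide (R b c) then b :: L else L) [] :=
    hl.foldr (K := fun a => codeSize (l a))
      (s := fun _ b L => bif L.all fun c => decide (R b c) then b :: L else L) (const [])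
      (by fun_prop) (by fun_prop) fun a L b hb => by
        have := codeSize_lt_of_mem hb
        cases L.all fun c => decide (R b c)
        · rw [cond_false]; omega
        · rw [cond_true, codeSize_cons]; omega
  simpa only [List.pwFilter, Bool.cond_eq_ite, List.all_eq_true, decide_eq_true_eq] using h

@[fun_prop]
theorem dedup (hl : PolyTime l) : PolyTime fun a => (l a).dedup :=
  hl.pwFilter (by simpa only [decide_not, beq_eq_decide] using
    (PolyTime.id.fst.beq_nat PolyTime.id.snd).not)

end ListNat

end PolyTime

/-! ### Reading and writing words -/

section Words

variable {A B : Type}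

/-- The alphabets of the input stack `inl false`, the output stack `inl true` and the stacks of a
program on trees. -/
def IOAlphabet (A B : Type) : Bool ⊕ TreeReg → Type
  | .inl false => A
  | .inl true => B
  | .inr _ => TreeToken

instance [Finite A] [Finite B] : ∀ k, Finite (IOAlphabet A B k)
  | .inl false => inferInstanceAs (Finite A)
  | .inl true => inferInstanceAs (Finite B)
  | .inr _ => inferInstanceAs (Finite TreeToken)

/-- The stacks with the given input, output and work stacks. -/
def ioStacks (i : List A) (o : List B) (s : TreeReg → List TreeToken) :
    ∀ k, List (IOAlphabet A B k)
  | .inl false => i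
  | .inl true => o
  | .inr k => s k

/-- A program on trees as a program with an input and an output stack. -/
def onWork (p : TreeProg) : StackProg (IOAlphabet A B) :=
  StackProg.lift (Γ' := IOAlphabet A B) .inr p

theorem onWork_run {p : TreeProg} {s s' : TreeReg → List TreeToken} {t : ℕ}
    (h : RunWithin p s t s') (i : List A) (o : List B) :
    RunWithin (onWork p) (ioStacks i o s) t (ioStacks i o s') := by
  obtain ⟨u, hu, run⟩ := h
  obtain ⟨S, hS, hwork, hio⟩ := run.lift (Γ' := IOAlphabet A B) (e := .inr)
    (S := ioStacks i o s) rfl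
  have : S = ioStacks i o s' := by
    funext k
    match k with
    | .inl false => exact hio _ (by simp)
    | .inl true => exact hio _ (by simp)
    | .inr k => exact congrFun hwork k
  exact ⟨u, hu, this ▸ hS⟩

theorem update_input (i j : List A) (o : List B) (s : TreeReg → List TreeToken) :
    Function.update (ioStacks i o s) (.inl false) j = ioStacks j o s := by
  funext k
  match k with
  | .inl false | .inl true | .inr _ => rfl

theorem update_output (i : List A) (o j : List B) (s : TreeReg → List TreeToken) :
    Function.update (ioStacks i o s) (.inl true) j = ioStacks i j s := by
  funext k
  match k with
  | .inl false | .inl true | .inr _ => rfl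

theorem update_work (i : List A) (o : List B) (m l s e c : List TreeToken) :
    Function.update (ioStacks i o (regs m s e c)) (.inr M) l = ioStacks i o (regs l s e c) := by
  funext k
  match k with
  | .inl false | .inl true | .inr M | .inr TreeReg.B | .inr E | .inr C => rfl

theorem single_inl_false (w : List A) :
    StackProg.single (Γ := IOAlphabet A B) (.inl false) w = ioStacks w [] (regs [] [] [] []) := by
  funext k
  match k with
  | .inl false | .inl true | .inr M | .inr TreeReg.B | .inr E | .inr C => rfl

theorem single_inl_true (w : List B) :
    StackProg.single (Γ := IOAlphabet A B) (.inl true) w = ioStacks [] w (regs [] [] [] []) := by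
  funext k
  match k with
  | .inl false | .inl true | .inr M | .inr TreeReg.B | .inr E | .inr C => rfl

/-- The program that moves the input to the main stack, as the reversed list of its letters. -/
def readInput [TreeCode A] : StackProg (IOAlphabet A B) :=
  .seq (onWork (pushList [.leaf])) (.loop (.inl false) Option.isSome fun o => match o with
    | some a => onWork (pushList (.node :: treeTokens (code (show A from a))))
    | none => .skip)

theorem readInput_run [TreeCode A] {K : ℕ} (hK : ∀ a : A, codeSize a ≤ K) (w : List A) :
    RunWithin readInput (ioStacks (B := B) w [] (regs [] [] [] [])) ((2 * K + 4) * w.length + 3)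
      (ioStacks [] [] (regs (treeTokens (code w.reverse)) [] [] [])) := by
  have loop_run (w v : List A) : RunWithin (.loop (.inl false) Option.isSome fun o => match o with
      | some a => onWork (pushList (.node :: treeTokens (code (show A from a))))
      | none => .skip) (ioStacks (B := B) w [] (regs (treeTokens (code v)) [] [] []))
      ((2 * K + 4) * w.length + 1)
      (ioStacks [] [] (regs (treeTokens (code (w.reverse ++ v))) [] [] [])) := by
    induction w generalizing v with
    | nil => exact .loop_exit (o := none) rfl rfl (update_input ..)
    | cons a w ih =>
      have hpush := onWork_run (B := B)
        (pushList_run (.node :: treeTokens (code a)) (treeTokens (code v)) [] [] []) w []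
      rw [List.length_cons, length_treeTokens] at hpush
      have := hK a
      rw [List.reverse_cons, List.append_assoc]
      exact (RunWithin.loop_step (o := some a) rfl rfl (update_input ..) hpush
        (ih (a :: v))).mono (by
          rw [codeSize] at this
          rw [List.length_cons]
          linarith)
  have h := loop_run w []
  rw [List.append_nil] at h
  exact (RunWithin.seq (onWork_run (pushList_run [.leaf] [] [] [] []) w []) h).mono
    (by rw [List.length_singleton]; omega)

/-- The position of a letter in a list of letters, as a list of empty trees. -/
def position [DecidableEq B] (L : List B) (b : B) : List (BinaryTree Unit) :=
  List.replicate (L.idxOf b) .nil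

/-- The program that reads a position in the list of letters and writes the letter. -/
def writeLetter : List B → StackProg (IOAlphabet A B)
  | [] => .skip
  | b :: L => .case (.inr M) fun o => match o with
    | some .node => .case (.inr M) fun _ => writeLetter L
    | _ => .push (.inl true) b

theorem writeLetter_run [DecidableEq B] {L : List B} {b : B} (hb : b ∈ L) (i : List A) (o : List B)
    (m s e c : List TreeToken) :
    RunWithin (writeLetter L) (ioStacks i o (regs (treeTokens (code (position L b)) ++ m) s e c))
      (2 * L.length) (ioStacks i (b :: o) (regs m s e c)) := by
  induction L with
  | nil => cases hb
  | cons d L ih =>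
    rw [position, List.idxOf_cons]
    obtain rfl | hd := eq_or_ne d b
    · rw [beq_self_eq_true, cond_true]
      exact (RunWithin.case (o := some .leaf) rfl (update_work ..)
        (.push (update_output ..))).mono (by rw [List.length_cons]; omega)
    · rw [beq_false_of_ne hd, cond_false]
      exact (RunWithin.case (o := some .node) rfl (update_work ..)
        (.case (o := some .leaf) rfl (update_work ..)
          (ih ((List.mem_cons.mp hb).resolve_left hd.symm)))).mono
        (by rw [List.length_cons]; omega)

/-- The program that moves the positions on the main stack to the output, in reverse order. -/
def writeOutput (L : List B) : StackProg (IOAlphabet A B) :=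
  .loop (.inr M) (fun o : Option TreeToken => o == some .node) fun _ => writeLetter L

theorem writeOutput_run [DecidableEq B] {L : List B} (hL : ∀ b, b ∈ L) (w v : List B) :
    RunWithin (writeOutput L)
      (ioStacks (A := A) [] v (regs (treeTokens (code (w.map (position L)))) [] [] []))
      ((2 * L.length + 1) * w.length + 1) (ioStacks [] (w.reverse ++ v) (regs [] [] [] [])) := by
  induction w generalizing v with
  | nil => exact .loop_exit (o := some .leaf) rfl rfl (update_work ..)
  | cons b w ih =>
    rw [List.reverse_cons, List.append_assoc]
    exact (RunWithin.loop_step (o := some .node) rfl rfl (update_work ..)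
      (writeLetter_run (hL b) ..) (ih (b :: v))).mono (by rw [List.length_cons]; linarith)

theorem codeSize_le_mul_length {K : ℕ} (hK : ∀ a : α, codeSize a ≤ K) (w : List α) :
    codeSize w ≤ (K + 1) * w.length := by
  induction w with
  | nil => rfl
  | cons a w ih =>
    rw [codeSize_cons, List.length_cons]
    linarith [hK a]

theorem PolyTime.computableInPolyTime {A B X Y : Type} [Finite A] [Finite B] [TreeCode A]
    [TreeCode B] {ea : X → List A} {eb : Y → List B} {f : X → Y} {g : List A → List B}
    (hg : PolyTime g) (h : ∀ x, g (ea x) = eb (f x)) :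
    Nonempty (Turing.TM2ComputableInPolyTime ea eb f) := by
  classical
  have := Fintype.ofFinite A
  have := Fintype.ofFinite B
  obtain ⟨K, hK⟩ : ∃ K, ∀ a : A, codeSize a ≤ K :=
    ⟨Finset.univ.sup codeSize, fun a => Finset.le_sup (Finset.mem_univ a)⟩
  let L := (Finset.univ : Finset B).toList
  have hL (b : B) : b ∈ L := Finset.mem_toList.mpr (Finset.mem_univ b)
  have hpos : PolyTime fun w : List A => (g w.reverse).reverse.map (position L) := by
    have : PolyTime (position L) := of_finite _
    fun_prop
  obtain ⟨p, q, hp⟩ := hpos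
  let Q := q.comp ((K + 1 : ℕ) * .X)
  refine StackProg.computableInPolyTime (Γ := IOAlphabet A B) (k₀ := .inl false) (k₁ := .inl true)
    (.seq readInput (.seq (onWork p) (writeOutput L)))
    ((2 * K + 4 : ℕ) * .X + 3 + (Q + ((2 * L.length + 1 : ℕ) * Q + 1))) fun x => ?_
  obtain ⟨hsize, hrun⟩ := hp (ea x).reverse
  simp only [List.reverse_reverse, h] at hsize hrun
  have hQ : q.eval (codeSize (ea x).reverse) ≤ Q.eval (ea x).length := by
    simpa [Q] using monotone_eval_nat q (codeSize_le_mul_length hK (ea x).reverse)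
  have hlen : (eb (f x)).reverse.length ≤ Q.eval (ea x).length := by
    simpa using (length_le_codeSize _).trans (hsize.trans hQ)
  have hwork := onWork_run (A := A) (B := B) (hrun [] [] [] []) [] []
  rw [List.append_nil, List.append_nil] at hwork
  have hout := writeOutput_run (A := A) hL (eb (f x)).reverse []
  rw [List.reverse_reverse, List.append_nil] at hout
  rw [single_inl_false, single_inl_true]
  refine (RunWithin.seq (readInput_run hK (ea x)) (.seq hwork hout)).mono ?_
  simp only [Polynomial.eval_add, Polynomial.eval_mul, Polynomial.eval_natCast, Polynomial.eval_X,
    Polynomial.eval_ofNat, Polynomial.eval_one, Nat.cast_id]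
  exact Nat.add_le_add_left (Nat.add_le_add hQ
    (Nat.add_le_add_right (Nat.mul_le_mul_left _ hlen) 1)) _

end Words

section Integers

instance : TreeCode ℤ where
  code z := code (z.toNat, (-z).toNat)
  code_injective x y h := by
    have h := code_injective h
    rw [Prod.mk.injEq] at h
    omega

namespace PolyTime

variable {z : α → ℤ}

@[fun_prop]
theorem toNat_int (hz : PolyTime z) : PolyTime fun a => (z a).toNat :=
  fst (f := fun a => ((z a).toNat, (-z a).toNat)) (hz.congr_code fun _ => rfl)

@[fun_prop]
theorem toNat_neg (hz : PolyTime z) : PolyTime fun a => (-z a).toNat :=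
  snd (f := fun a => ((z a).toNat, (-z a).toNat)) (hz.congr_code fun _ => rfl)

@[fun_prop]
theorem natCast_sub {f g : α → ℕ} (hf : PolyTime f) (hg : PolyTime g) :
    PolyTime fun a => (f a : ℤ) - g a := by
  refine ((hf.sub hg).prodMk (hg.sub hf)).congr_code fun a => ?_
  change code (((f a : ℤ) - g a).toNat, (-((f a : ℤ) - g a)).toNat) = code (f a - g a, g a - f a)
  congr 2 <;> omega

@[fun_prop]
theorem natAbs (hz : PolyTime z) : PolyTime fun a => (z a).natAbs := by
  simp_rw [← Int.toNat_add_toNat_neg_eq_natAbs]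
  fun_prop

@[fun_prop]
theorem decide_neg (hz : PolyTime z) : PolyTime fun a => decide (z a < 0) := by
  have h : PolyTime fun a => decide (0 < (-z a).toNat) := by fun_prop
  simpa only [Int.lt_toNat, Nat.cast_zero, Left.neg_pos_iff] using h

@[fun_prop]
theorem const_mul_natCast (c : ℤ) {f : α → ℕ} (hf : PolyTime f) :
    PolyTime fun a => c * (f a : ℤ) := by
  have h : PolyTime fun a => ((c.toNat * f a : ℕ) : ℤ) - ((-c).toNat * f a : ℕ) := by fun_prop
  convert h using 2 with a
  rw [Nat.cast_mul, Nat.cast_mul, ← sub_mul, Int.toNat_sub_toNat_neg]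

@[fun_prop]
theorem sum_int {l : α → List ℤ} (hl : PolyTime l) : PolyTime fun a => (l a).sum := by
  have h : PolyTime fun a => ((((l a).map fun z => z.toNat).sum : ℕ) : ℤ) -
      ((l a).map fun z => (-z).toNat).sum := by fun_prop
  convert h using 2 with a
  induction l a with
  | nil => rfl
  | cons z l ih =>
    rw [List.sum_cons, ih, List.map_cons, List.map_cons, List.sum_cons, List.sum_cons]
    omega

end PolyTime

end Integers

/-- The numbers in binary as codes of the members of a finite type. -/
@[reducible]
noncomputable def TreeCode.ofFinite (α : Type) [Finite α] : TreeCode α where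
  code a := code (Finite.equivFin α a : ℕ)
  code_injective _ _ h := (Finite.equivFin α).injective (Fin.ext (code_injective h))

theorem encodePosNum_eq_bits (m : PosNum) : Computability.encodePosNum m = (m : ℕ).bits := by
  induction m with
  | one => simp [Computability.encodePosNum]
  | bit1 m ih => rw [Computability.encodePosNum, ih, PosNum.cast_bit1, ← two_mul, Nat.bit1_bits]
  | bit0 m ih =>
    rw [Computability.encodePosNum, ih, PosNum.cast_bit0, ← two_mul,
      Nat.bit0_bits _ (PosNum.cast_pos m).ne']

theorem encodeNat_eq_bits (n : ℕ) : Computability.encodeNat n = n.bits := by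
  rw [Computability.encodeNat]
  conv_rhs => rw [← Num.to_of_nat n]
  cases (n : Num) with
  | zero => simp [Computability.encodeNum]
  | pos m => exact encodePosNum_eq_bits m

namespace MaxCSPKernel

open MaxCSP

noncomputable instance : TreeCode Sym := .ofFinite Sym

noncomputable instance : TreeCode (Sym ⊕ Bool) := .ofFinite (Sym ⊕ Bool)

/-- A constraint as a piece of data: the list of its variables, its truth table, its weight. -/
abbrev RawConstraint := List ℕ × List Bool × ℕ

/-- The data of a constraint. -/
def raw {r n : ℕ} (c : Constraint r n) : RawConstraint := (c.vars, c.truthTable, c.weight)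

/-- The word of a constraint. -/
def encodeRaw (c : RawConstraint) : List Sym :=
  c.1.flatMap (fun v => Sym.arg :: encodeNum v) ++
    Sym.table :: (encodeBits c.2.1 ++ encodeNum c.2.2)

/-- The word of an instance with `n` variables, given the data of its constraints, and a
parameter. -/
def encodeRawPair (n : ℕ) (cs : List RawConstraint) (k : ℕ) : List (Sym ⊕ Bool) :=
  (List.replicate n Sym.var ++ cs.flatMap encodeRaw).map .inl ++
    (Computability.encodeNat k).map .inr

theorem encodePair_eq {r : ℕ} (I : Instance r) (k : ℕ) :
    (MaxCSPAA r).encodePair (I, k) = encodeRawPair I.n (I.constraints.map raw) k := by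
  rw [encodeRawPair, List.flatMap_map]
  rfl

/-! ### Parsing -/

/-- The state of the parser, which reads a word from right to left: the bit strings that do not
belong to a constraint yet, and the constraints, the last of which may be incomplete. -/
abbrev ParseState := List (List Bool) × List RawConstraint

/-- The step of the parser for one symbol. -/
def parseStep : Sym ⊕ Bool → ParseState → ParseState
  | .inl (.bit b), s | .inr b, s => ((b :: s.1.headD []) :: s.1.tail, s.2)
  | .inl .endMark, s => ([] :: s.1, s.2)
  | .inl .var, s => s
  | .inl .table, s => (s.1.tail.tail,
      ([], s.1.headD [], natOfBits (s.1.tail.headD [])) :: s.2)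
  | .inl .arg, s => (s.1.tail, (natOfBits (s.1.headD []) :: (s.2.headD ([], [], 0)).1,
      (s.2.headD ([], [], 0)).2) :: s.2.tail)

/-- The constraints and the parameter that a word encodes. -/
def parse (w : List (Sym ⊕ Bool)) : List RawConstraint × ℕ :=
  let s := w.foldr parseStep ([], [])
  (s.2, natOfBits (s.1.headD []))

section Parse

variable (bs : List Bool) (l : List (List Bool)) (cs : List RawConstraint)

theorem foldr_parseStep_inr :
    (bs.map .inr).foldr parseStep ([], []) = (if bs = [] then [] else [bs], []) := by
  induction bs with
  | nil => rfl
  | cons b bs ih =>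
    rw [List.map_cons, List.foldr_cons, ih]
    rcases bs with _ | _ <;> rfl

theorem foldr_parseStep_encodeBits :
    ((encodeBits bs).map .inl).foldr parseStep (l, cs) = (bs :: l, cs) := by
  induction bs with
  | nil => rfl
  | cons b bs ih => exact congrArg (parseStep (.inl (.bit b))) ih

theorem foldr_parseStep_vars (vs us : List ℕ) (d : List Bool × ℕ) :
    ((vs.flatMap fun v => Sym.arg :: encodeNum v).map .inl).foldr parseStep (l, (us, d) :: cs) =
      (l, (vs ++ us, d) :: cs) := by
  induction vs with
  | nil => rfl
  | cons v vs ih =>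
    rw [List.flatMap_cons, List.map_append, List.foldr_append, ih, List.map_cons, List.foldr_cons,
      encodeNum, foldr_parseStep_encodeBits, encodeNat_eq_bits]
    simp only [parseStep, List.headD_cons, List.tail_cons, natOfBits_bits, List.cons_append]

theorem foldr_parseStep_encodeRaw (c : RawConstraint) :
    ((encodeRaw c).map .inl).foldr parseStep (l, cs) = (l, c :: cs) := by
  rw [encodeRaw, List.map_append, List.foldr_append, List.map_cons, List.foldr_cons,
    List.map_append, List.foldr_append, encodeNum, foldr_parseStep_encodeBits,
    foldr_parseStep_encodeBits]
  simp only [parseStep, List.headD_cons, List.tail_cons]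
  rw [foldr_parseStep_vars, encodeNat_eq_bits, natOfBits_bits, List.append_nil]

theorem foldr_parseStep_encodeRawPair (n k : ℕ) :
    (encodeRawPair n cs k).foldr parseStep ([], []) =
      (if k.bits = [] then [] else [k.bits], cs) := by
  rw [encodeRawPair, List.foldr_append, encodeNat_eq_bits, foldr_parseStep_inr, List.map_append,
    List.foldr_append]
  have hvar (s : ParseState) :
      ((List.replicate n Sym.var).map .inl).foldr parseStep s = s := by
    induction n with
    | zero => rfl
    | succ _ ih => exact ih
  rw [hvar]
  induction cs with
  | nil => rfl
  | cons c cs ih =>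
    rw [List.flatMap_cons, List.map_append, List.foldr_append, ih, foldr_parseStep_encodeRaw]

theorem parse_encodeRawPair (n k : ℕ) : parse (encodeRawPair n cs k) = (cs, k) := by
  simp only [parse, foldr_parseStep_encodeRawPair]
  conv_rhs => rw [← natOfBits_bits k]
  rcases k.bits with _ | _ <;> rfl

end Parse

theorem codeSize_parseStep_le (a : Sym ⊕ Bool) (s : ParseState) :
    codeSize (parseStep a s) ≤ codeSize s + 20 := by
  have h₁ := codeSize_headD_add_tail_le s.1 []
  have h₂ := codeSize_headD_add_tail_le s.1.tail []
  have h₃ := codeSize_headD_add_tail_le s.2 ([], [], 0)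
  have h₄ := codeSize_natOfBits_le (s.1.headD [])
  have h₅ := codeSize_natOfBits_le (s.1.tail.headD [])
  have hdefault : codeSize (([], [], 0) : RawConstraint) = 2 := rfl
  have hhead (c : RawConstraint) : codeSize c = codeSize c.1 + codeSize c.2 + 1 := rfl
  have hstate : codeSize s = codeSize s.1 + codeSize s.2 + 1 := rfl
  rw [hhead (s.2.headD _), hdefault] at h₃
  rw [codeSize_nil] at h₁ h₂
  rw [hstate]
  rcases a with (b | _ | _ | _ | _) | b <;>
    simp only [parseStep, codeSize_pair, codeSize_cons, codeSize_nil, codeSize_bool] <;> omega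

@[fun_prop]
theorem parse_polyTime : PolyTime parse := by
  have hstep : PolyTime fun p : List (Sym ⊕ Bool) × (Sym ⊕ Bool) × ParseState =>
      parseStep p.2.1 p.2.2 := by
    refine .cases_finite (f := fun p : List (Sym ⊕ Bool) × (Sym ⊕ Bool) × ParseState => p.2.1)
      (F := fun a p => parseStep a p.2.2) (by fun_prop) fun a => ?_
    rcases a with (b | _ | _ | _ | _) | b <;> simp only [parseStep] <;> fun_prop
  have hs : PolyTime fun w : List (Sym ⊕ Bool) => w.foldr parseStep ([], []) :=
    .foldr .id (.const _) hstep (PolyBounded.const 20) fun _ s a _ => codeSize_parseStep_le a s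
  have : PolyTime fun s : ParseState => (s.2, natOfBits (s.1.headD [])) := by fun_prop
  exact this.comp hs

end MaxCSPKernel

/-! ### Walsh expansions -/

section Walsh

open Finset

variable {V V' : Type*} [DecidableEq V] [DecidableEq V']

/-- The Walsh function of the set `S` of variables: the product of the signs of its members at the
assignment in which exactly the members of `T` are true, true having the sign `-1`. -/
def walsh (S T : Finset V) : ℤ := (-1) ^ #(S ∩ T)

theorem walsh_comm (S T : Finset V) : walsh S T = walsh T S := by rw [walsh, inter_comm, walsh]

theorem walsh_empty_left (T : Finset V) : walsh ∅ T = 1 := by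
  rw [walsh, empty_inter, card_empty, pow_zero]

theorem walsh_mul_self (S T : Finset V) : walsh S T * walsh S T = 1 := by
  rw [walsh, ← mul_pow, neg_one_mul, neg_neg, one_pow]

theorem walsh_eq_one_or (S T : Finset V) : walsh S T = 1 ∨ walsh S T = -1 :=
  neg_one_pow_eq_or ℤ _

theorem walsh_insert_right_of_mem {S T : Finset V} {v : V} (hS : v ∈ S) (hT : v ∉ T) :
    walsh S (insert v T) = -walsh S T := by
  rw [walsh, inter_insert_of_mem hS, card_insert_of_notMem (by simp [hT]), pow_succ, mul_neg_one,
    walsh]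

theorem walsh_insert_right_of_notMem {S : Finset V} {v : V} (hS : v ∉ S) (T : Finset V) :
    walsh S (insert v T) = walsh S T := by
  rw [walsh, inter_insert_of_notMem hS, walsh]

theorem walsh_insert_left_of_notMem {T : Finset V} {v : V} (hT : v ∉ T) (S : Finset V) :
    walsh (insert v S) T = walsh S T := by
  rw [walsh_comm, walsh_insert_right_of_notMem hT, walsh_comm]

theorem walsh_image {S : Finset V} {f : V → V'} (hf : Set.InjOn f S) {T : Finset V}
    {T' : Finset V'} (h : ∀ v ∈ S, f v ∈ T' ↔ v ∈ T) : walsh (S.image f) T' = walsh S T := by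
  have hST : S.image f ∩ T' = (S ∩ T).image f := by
    ext w
    simp only [mem_inter, mem_image]
    constructor
    · rintro ⟨⟨v, hv, rfl⟩, hw⟩
      exact ⟨v, ⟨hv, (h v hv).mp hw⟩, rfl⟩
    · rintro ⟨v, ⟨hv, hvT⟩, rfl⟩
      exact ⟨⟨v, hv, rfl⟩, (h v hv).mpr hvT⟩
  rw [walsh, hST, card_image_of_injOn (hf.mono (by simp)), walsh]

theorem sum_powerset_eq_zero_of_insert_eq_neg {W : Finset V} {v : V} (hv : v ∈ W)
    {f : Finset V → ℤ} (hf : ∀ T, v ∉ T → f (insert v T) = -f T) : ∑ T ∈ W.powerset, f T = 0 := by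
  rw [← insert_erase hv, sum_powerset_insert (notMem_erase v W), ← sum_add_distrib]
  refine sum_eq_zero fun T hT => ?_
  rw [hf T fun h => notMem_erase v W (mem_powerset.mp hT h), add_neg_cancel]

theorem sum_walsh_mul_walsh {W S S' : Finset V} (hS : S ⊆ W) (hS' : S' ⊆ W) :
    ∑ T ∈ W.powerset, walsh S T * walsh S' T = if S = S' then 2 ^ #W else 0 := by
  split_ifs with h
  · subst h
    simp only [walsh_mul_self, sum_const, card_powerset, nsmul_one, Nat.cast_pow, Nat.cast_ofNat]
  · obtain ⟨v, hv⟩ := not_forall.mp (mt Finset.ext h)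
    have hvW : v ∈ W := by grind
    refine sum_powerset_eq_zero_of_insert_eq_neg hvW fun T hT => ?_
    by_cases hvS : v ∈ S
    · have hvS' : v ∉ S' := by simpa [hvS] using hv
      rw [walsh_insert_right_of_mem hvS hT, walsh_insert_right_of_notMem hvS', neg_mul]
    · have hvS' : v ∈ S' := by simpa [hvS] using hv
      rw [walsh_insert_right_of_mem hvS' hT, walsh_insert_right_of_notMem hvS, mul_neg]

/-- The multilinear polynomial in the signs of the members of `W` with the coefficients `c`. -/
def walshSum (W : Finset V) (c : Finset V → ℤ) (T : Finset V) : ℤ :=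
  ∑ S ∈ W.powerset, c S * walsh S T

variable {W : Finset V} {c : Finset V → ℤ}

theorem walshSum_walshSum (c : Finset V → ℤ) {T : Finset V} (hT : T ⊆ W) :
    walshSum W (walshSum W c) T = 2 ^ #W * c T := by
  simp only [walshSum, sum_mul, mul_assoc]
  rw [sum_comm]
  simp only [← mul_sum]
  have h {U : Finset V} (hU : U ∈ W.powerset) :
      ∑ S ∈ W.powerset, walsh U S * walsh S T = if U = T then 2 ^ #W else 0 := by
    simpa only [walsh_comm _ T] using sum_walsh_mul_walsh (mem_powerset.mp hU) hT
  rw [sum_congr rfl fun U hU => by rw [h hU]]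
  simp only [mul_ite, mul_zero, sum_ite_eq', mem_powerset, hT, if_true, mul_comm]

theorem sum_walshSum (W : Finset V) (c : Finset V → ℤ) :
    ∑ T ∈ W.powerset, walshSum W c T = 2 ^ #W * c ∅ := by
  have h : ∑ T ∈ W.powerset, walshSum W c T * walsh T ∅ = 2 ^ #W * c ∅ :=
    walshSum_walshSum c (empty_subset W)
  simpa only [walsh_comm _ ∅, walsh_empty_left, mul_one] using h

theorem sum_walshSum_sq (W : Finset V) (c : Finset V → ℤ) :
    ∑ T ∈ W.powerset, walshSum W c T ^ 2 = 2 ^ #W * ∑ S ∈ W.powerset, c S ^ 2 := by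
  calc ∑ T ∈ W.powerset, walshSum W c T ^ 2
      = ∑ T ∈ W.powerset, ∑ S ∈ W.powerset, c S * (walshSum W c T * walsh T S) := by
        refine sum_congr rfl fun T _ => ?_
        conv_lhs => rw [sq]; enter [2]; rw [walshSum]
        rw [mul_sum]
        exact sum_congr rfl fun S _ => by rw [walsh_comm, mul_left_comm]
    _ = ∑ S ∈ W.powerset, c S * walshSum W (walshSum W c) S := by
        rw [sum_comm]
        exact sum_congr rfl fun S _ => (mul_sum _ _ _).symm
    _ = 2 ^ #W * ∑ S ∈ W.powerset, c S ^ 2 := by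
        rw [mul_sum]
        refine sum_congr rfl fun S hS => ?_
        rw [walshSum_walshSum c (mem_powerset.mp hS)]
        ring

theorem walshSum_insert {v : V} (hv : v ∉ W) {T : Finset V} (hT : v ∉ T) :
    walshSum (insert v W) c T = walshSum W c T + walshSum W (fun S => c (insert v S)) T := by
  simp only [walshSum, sum_powerset_insert hv, walsh_insert_left_of_notMem hT]

theorem walshSum_insert_insert {v : V} (hv : v ∉ W) {T : Finset V} (hT : v ∉ T) :
    walshSum (insert v W) c (insert v T) =
      walshSum W c T - walshSum W (fun S => c (insert v S)) T := by
  have hS {S : Finset V} (hS : S ∈ W.powerset) : v ∉ S := fun h => hv (mem_powerset.mp hS h)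
  simp only [walshSum, sum_powerset_insert hv, walsh_insert_right_of_mem (mem_insert_self v _) hT,
    walsh_insert_left_of_notMem hT, mul_neg, sum_neg_distrib, sub_eq_add_neg]
  rw [sum_congr rfl fun S hS' => by rw [walsh_insert_right_of_notMem (hS hS')]]

theorem sum_walshSum_insert_pow {v : V} (hv : v ∉ W) (k : ℕ) :
    ∑ T ∈ (insert v W).powerset, walshSum (insert v W) c T ^ k =
      ∑ T ∈ W.powerset, (walshSum W c T + walshSum W (fun S => c (insert v S)) T) ^ k +
        ∑ T ∈ W.powerset, (walshSum W c T - walshSum W (fun S => c (insert v S)) T) ^ k := by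
  have hT {T : Finset V} (hT : T ∈ W.powerset) : v ∉ T := fun h => hv (mem_powerset.mp hT h)
  rw [sum_powerset_insert hv]
  congr 1 <;> refine sum_congr rfl fun T h => ?_
  · rw [walshSum_insert hv (hT h)]
  · rw [walshSum_insert_insert hv (hT h)]

theorem fourth_moment_add_sub_le {ι : Type*} (s : Finset ι) (q p : ι → ℤ) {N K : ℤ} (hN : 0 ≤ N)
    (hK : 0 ≤ K) (hq : N * ∑ i ∈ s, q i ^ 4 ≤ K * (∑ i ∈ s, q i ^ 2) ^ 2)
    (hp : 9 * (N * ∑ i ∈ s, p i ^ 4) ≤ K * (∑ i ∈ s, p i ^ 2) ^ 2) :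
    2 * N * (∑ i ∈ s, (q i + p i) ^ 4 + ∑ i ∈ s, (q i - p i) ^ 4) ≤
      K * (∑ i ∈ s, (q i + p i) ^ 2 + ∑ i ∈ s, (q i - p i) ^ 2) ^ 2 := by
  set Q₂ := ∑ i ∈ s, q i ^ 2
  set P₂ := ∑ i ∈ s, p i ^ 2
  set Q₄ := ∑ i ∈ s, q i ^ 4
  set P₄ := ∑ i ∈ s, p i ^ 4
  set M := ∑ i ∈ s, q i ^ 2 * p i ^ 2
  have hfourth : ∑ i ∈ s, (q i + p i) ^ 4 + ∑ i ∈ s, (q i - p i) ^ 4 =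
      2 * Q₄ + 12 * M + 2 * P₄ := by
    simp only [Q₄, M, P₄, mul_sum, ← sum_add_distrib]
    exact sum_congr rfl fun i _ => by ring
  have hsecond : ∑ i ∈ s, (q i + p i) ^ 2 + ∑ i ∈ s, (q i - p i) ^ 2 = 2 * (Q₂ + P₂) := by
    simp only [Q₂, P₂, mul_sum, ← sum_add_distrib]
    exact sum_congr rfl fun i _ => by ring
  have hP₄ : 0 ≤ P₄ := sum_nonneg fun i _ => by positivity
  have hmixed : 3 * (N * M) ≤ K * (Q₂ * P₂) := by
    refine (abs_le_of_sq_le_sq' ?_ (by positivity)).2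
    have hM : M ^ 2 ≤ Q₄ * P₄ := by
      have h := sum_mul_sq_le_sq_mul_sq s (fun i => q i ^ 2) fun i => p i ^ 2
      simpa only [← pow_mul, Nat.reduceMul] using h
    calc (3 * (N * M)) ^ 2 = 9 * N ^ 2 * M ^ 2 := by ring
      _ ≤ 9 * N ^ 2 * (Q₄ * P₄) := by gcongr
      _ = (N * Q₄) * (9 * (N * P₄)) := by ring
      _ ≤ (K * Q₂ ^ 2) * (K * P₂ ^ 2) := by gcongr
      _ = (K * (Q₂ * P₂)) ^ 2 := by ring
  rw [hfourth, hsecond]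
  linarith [mul_nonneg hN hP₄]

theorem fourth_moment_walshSum_le {d : ℕ} (hc : ∀ S ⊆ W, d < #S → c S = 0) :
    2 ^ #W * ∑ T ∈ W.powerset, walshSum W c T ^ 4 ≤
      9 ^ d * (∑ T ∈ W.powerset, walshSum W c T ^ 2) ^ 2 := by
  induction W using Finset.induction_on generalizing c d with
  | empty =>
    simp only [card_empty, pow_zero, powerset_empty, sum_singleton, one_mul, ← pow_mul]
    exact le_mul_of_one_le_left (by positivity) (one_le_pow₀ (by norm_num))
  | insert v W hv ih =>
    have hq := ih (c := c) (d := d) fun S hS => hc S (hS.trans (subset_insert v W))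
    have hp : 9 * (2 ^ #W * ∑ T ∈ W.powerset, walshSum W (fun S => c (insert v S)) T ^ 4) ≤
        9 ^ d * (∑ T ∈ W.powerset, walshSum W (fun S => c (insert v S)) T ^ 2) ^ 2 := by
      have hcard {S : Finset V} (hS : S ⊆ W) : #(insert v S) = #S + 1 :=
        card_insert_of_notMem fun h => hv (hS h)
      cases d with
      | zero =>
        have hzero (T : Finset V) : walshSum W (fun S => c (insert v S)) T = 0 :=
          sum_eq_zero fun S hS => by
            rw [mem_powerset] at hS
            exact mul_eq_zero_of_left
              (hc _ (insert_subset_insert v hS) (by rw [hcard hS]; omega)) _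
        simp [hzero]
      | succ d =>
        rw [pow_succ', mul_assoc]
        exact mul_le_mul_of_nonneg_left (ih fun S hS hd =>
          hc _ (insert_subset_insert v hS) (by rw [hcard hS]; omega)) (by norm_num)
    rw [card_insert_of_notMem hv, pow_succ', sum_walshSum_insert_pow hv, sum_walshSum_insert_pow hv]
    exact fourth_moment_add_sub_le _ _ _ (by positivity) (by positivity) hq hp

theorem sum_sq_pow_three_le {ι : Type*} (s : Finset ι) (f : ι → ℤ) :
    (∑ i ∈ s, f i ^ 2) ^ 3 ≤ (∑ i ∈ s, |f i|) ^ 2 * ∑ i ∈ s, f i ^ 4 := by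
  have h₀ : 0 ≤ ∑ i ∈ s, f i ^ 2 := sum_nonneg fun i _ => sq_nonneg _
  have h₁ : (∑ i ∈ s, f i ^ 2) ^ 2 ≤ (∑ i ∈ s, |f i|) * ∑ i ∈ s, |f i| ^ 3 :=
    sum_sq_le_sum_mul_sum_of_sq_le_mul s (fun i _ => abs_nonneg _) (fun i _ => by positivity)
      fun i _ => by rw [← pow_succ', ← pow_mul, Even.pow_abs (by decide)]
  have h₂ : (∑ i ∈ s, |f i| ^ 3) ^ 2 ≤ (∑ i ∈ s, f i ^ 2) * ∑ i ∈ s, f i ^ 4 :=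
    sum_sq_le_sum_mul_sum_of_sq_le_mul s (fun i _ => by positivity) (fun i _ => by positivity)
      fun i _ => by rw [← pow_add, ← pow_mul, Even.pow_abs (by decide)]
  obtain h | h := h₀.eq_or_lt
  · rw [← h, zero_pow three_ne_zero]
    positivity
  refine le_of_mul_le_mul_left ?_ h
  calc (∑ i ∈ s, f i ^ 2) * (∑ i ∈ s, f i ^ 2) ^ 3 = ((∑ i ∈ s, f i ^ 2) ^ 2) ^ 2 := by ring
    _ ≤ ((∑ i ∈ s, |f i|) * ∑ i ∈ s, |f i| ^ 3) ^ 2 := by gcongr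
    _ = (∑ i ∈ s, |f i|) ^ 2 * (∑ i ∈ s, |f i| ^ 3) ^ 2 := mul_pow _ _ _
    _ ≤ (∑ i ∈ s, |f i|) ^ 2 * ((∑ i ∈ s, f i ^ 2) * ∑ i ∈ s, f i ^ 4) := by gcongr
    _ = _ := by ring

theorem sum_abs_walshSum_le (h₀ : c ∅ = 0) {K : ℤ} (hK : 0 ≤ K)
    (hle : ∀ T ⊆ W, walshSum W c T ≤ K) :
    ∑ T ∈ W.powerset, |walshSum W c T| ≤ 2 * 2 ^ #W * K := by
  calc ∑ T ∈ W.powerset, |walshSum W c T|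
      = ∑ T ∈ W.powerset, (|walshSum W c T| + walshSum W c T) := by
        rw [sum_add_distrib, sum_walshSum, h₀, mul_zero, add_zero]
    _ ≤ ∑ T ∈ W.powerset, 2 * K := by
        refine sum_le_sum fun T hT => ?_
        have := hle T (mem_powerset.mp hT)
        rcases abs_cases (walshSum W c T) with h | h <;> omega
    _ = 2 * 2 ^ #W * K := by
        rw [sum_const, card_powerset, nsmul_eq_mul]
        push_cast
        ring

theorem sum_sq_le_of_walshSum_le {d : ℕ} (hc : ∀ S ⊆ W, d < #S → c S = 0) (h₀ : c ∅ = 0) {K : ℤ}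
    (hK : 0 ≤ K) (hle : ∀ T ⊆ W, walshSum W c T ≤ K) :
    ∑ S ∈ W.powerset, c S ^ 2 ≤ 4 * 9 ^ d * K ^ 2 := by
  set A := ∑ S ∈ W.powerset, c S ^ 2
  set N : ℤ := 2 ^ #W
  have hA : 0 ≤ A := sum_nonneg fun S _ => sq_nonneg _
  have hfourth := fourth_moment_walshSum_le hc
  have hthree := sum_sq_pow_three_le W.powerset (walshSum W c)
  have habs := sum_abs_walshSum_le h₀ hK hle
  rw [sum_walshSum_sq] at hfourth hthree
  obtain h | hApos := hA.eq_or_lt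
  · rw [← h]
    positivity
  refine le_of_mul_le_mul_left ?_ (show 0 < N ^ 4 * A ^ 2 by positivity)
  calc N ^ 4 * A ^ 2 * A = N * (N * A) ^ 3 := by ring
    _ ≤ N * ((∑ T ∈ W.powerset, |walshSum W c T|) ^ 2 * ∑ T ∈ W.powerset, walshSum W c T ^ 4) := by
        gcongr
    _ = (∑ T ∈ W.powerset, |walshSum W c T|) ^ 2 *
          (N * ∑ T ∈ W.powerset, walshSum W c T ^ 4) := by ring
    _ ≤ (2 * N * K) ^ 2 * (9 ^ d * (N * A) ^ 2) := by gcongr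
    _ = N ^ 4 * A ^ 2 * (4 * 9 ^ d * K ^ 2) := by ring

end Walsh

namespace PolyTime

theorem getD_const {l : α → List β} (hl : PolyTime l) (i : ℕ) (d : β) :
    PolyTime fun a => (l a).getD i d := by
  induction i generalizing l with
  | zero => simpa only [List.headD_eq_getD] using hl.headD (const d)
  | succ i ih =>
    convert ih hl.tail using 2 with a
    cases l a <;> rfl

theorem map_const {ι : Type*} (l : List ι) {g : ι → α → β} (hg : ∀ i, PolyTime (g i)) :
    PolyTime fun a => l.map fun i => g i a := by
  induction l with
  | nil => exact const []
  | cons i l ih => exact (hg i).cons ih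

@[fun_prop]
theorem decide_toFinset_eq {l l' : α → List ℕ} (hl : PolyTime l) (hl' : PolyTime l') :
    PolyTime fun a => decide ((l a).toFinset = (l' a).toFinset) := by
  have h : PolyTime fun a => (l a).all (l' a).elem && (l' a).all (l a).elem := by
    fun_prop
  convert h using 2 with a
  rw [Bool.eq_iff_iff]
  simp [Finset.Subset.antisymm_iff, Finset.subset_iff]

end PolyTime

namespace MaxCSPKernel

open MaxCSP

section Coefficients

/-- A term `c * walsh S` of a multilinear polynomial, with `S` given as a list. -/
abbrev Term := List ℕ × ℤ

/-- The value of the sum of the terms `ts` at the assignment in which exactly the members of `T`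
are true. -/
def evalTerms (ts : List Term) (T : Finset ℕ) : ℤ :=
  (ts.map fun t => t.2 * walsh t.1.toFinset T).sum

/-- The Boolean function with the truth table `t`, as a function on the sets of true arguments. -/
def tableIndicator (a : ℕ) (t : List Bool) (U : Finset (Fin a)) : ℤ :=
  (t.getD (Nat.ofBits fun i => decide (i ∈ U)) false).toNat

/-- The nonconstant terms of the Fourier expansion of a constraint, scaled by `2 ^ r`. Data that do
not describe a constraint have no terms. -/
noncomputable def terms (r : ℕ) (c : RawConstraint) : List Term :=
  if c.1.length ≤ r ∧ c.2.1.length = 2 ^ c.1.length then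
    (Finset.univ.erase (∅ : Finset (Fin c.1.length))).toList.map fun S =>
      (S.toList.map fun i : Fin _ => c.1.getD i 0,
        2 ^ (r - c.1.length) * walshSum .univ (tableIndicator c.1.length c.2.1) S * c.2.2)
  else []

theorem finite_tables (r : ℕ) :
    {p : ℕ × List Bool | p.1 ≤ r ∧ p.2.length = 2 ^ p.1}.Finite := by
  refine ((Set.finite_Iic r).prod (List.finite_length_le Bool (2 ^ r))).subset ?_
  rintro ⟨a, t⟩ ⟨ha, ht⟩
  exact ⟨ha, ht.trans_le (Nat.pow_le_pow_right two_pos ha)⟩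

@[fun_prop]
theorem terms_polyTime (r : ℕ) : PolyTime (terms r) := by
  refine .cases_mem_finite (f := fun c : RawConstraint => (c.1.length, c.2.1))
    (F := fun p c => (Finset.univ.erase (∅ : Finset (Fin p.1))).toList.map fun S =>
      (S.toList.map fun i : Fin _ => c.1.getD i 0,
        2 ^ (r - p.1) * walshSum .univ (tableIndicator p.1 p.2) S * c.2.2))
    (by fun_prop) (finite_tables r) (fun p => .map_const _ fun S => ?_) (.const [])
  refine .prodMk (.map_const _ fun i => .getD_const (by fun_prop) _ _) ?_
  fun_prop

/-- The sets of variables of the terms, each listed once. -/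
def supports (ts : List Term) : List (List ℕ) :=
  (ts.map Prod.fst).pwFilter fun s s' => s.toFinset ≠ s'.toFinset

/-- The coefficient of `walsh S` in the sum of the terms. -/
def coefficient (ts : List Term) (S : Finset ℕ) : ℤ :=
  ((ts.filter fun t => t.1.toFinset = S).map Prod.snd).sum

/-- The nonzero terms of the sum of the terms, like terms having been collected. -/
def collect (ts : List Term) : List Term :=
  ((supports ts).map fun s => (s, coefficient ts s.toFinset)).filter fun t => t.2 ≠ 0

@[fun_prop]
theorem collect_polyTime : PolyTime collect := by
  have hsupports : PolyTime supports :=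
    .pwFilter (by fun_prop) (by simp only [ne_eq, decide_not]; fun_prop)
  have hcoefficient : PolyTime fun p : List Term × List ℕ => coefficient p.1 p.2.toFinset := by
    unfold coefficient
    fun_prop
  have hne : PolyTime fun p : List Term × Term => decide (p.2.2 ≠ 0) := by
    simpa only [ne_eq, decide_not] using PolyTime.not (.decide_eq_const (by fun_prop) 0)
  exact .filter (.map hsupports (.prodMk (by fun_prop) hcoefficient)) hne

/-- The variables that occur in the terms. -/
def termVars (ts : List Term) : List ℕ := (ts.flatMap Prod.fst).dedup

end Coefficients

section ParityConstraints

/-- The Boolean function on `a` variables that is true where the product of their signs is `1`,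
respectively `-1` if `neg` holds. -/
def parityFunc (a : ℕ) (neg : Bool) (y : Fin a → Bool) : Bool :=
  decide (walsh .univ ({i | y i} : Finset (Fin a)) = if neg then -1 else 1)

/-- The truth table of `parityFunc a neg`. -/
def parityTable (a : ℕ) (neg : Bool) : List Bool :=
  (List.range (2 ^ a)).map fun i => parityFunc a neg fun j => i.testBit j

/-- The data of the constraint whose weight minus its average is the term `t`, the variables being
renumbered by their positions in `W`. -/
def rawParity (r : ℕ) (W : List ℕ) (t : Term) : RawConstraint :=
  (t.1.map W.idxOf,
    if t.1.length ≤ r then parityTable t.1.length (decide (t.2 < 0)) else [], 2 * t.2.natAbs)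

@[fun_prop]
theorem rawParity_polyTime (r : ℕ) : PolyTime fun p : List ℕ × Term => rawParity r p.1 p.2 := by
  have htable : PolyTime fun t : Term =>
      if t.1.length ≤ r then parityTable t.1.length (decide (t.2 < 0)) else [] :=
    .cases_mem_finite (f := fun t : Term => (t.1.length, decide (t.2 < 0)))
      (F := fun p _ => parityTable p.1 p.2) (s := fun p => p.1 ≤ r) (by fun_prop)
      (((Set.finite_Iic r).prod Set.finite_univ).subset fun p hp => ⟨hp, trivial⟩)
      (fun p => .const _) (.const [])
  have := htable.comp (f := fun p : List ℕ × Term => p.2) (by fun_prop)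
  unfold rawParity
  fun_prop

end ParityConstraints

@[fun_prop]
theorem encodeBits_polyTime : PolyTime encodeBits := by
  have : PolyTime Sym.bit := .of_finite _
  unfold encodeBits
  fun_prop

@[fun_prop]
theorem encodeRaw_polyTime : PolyTime encodeRaw := by
  have : PolyTime fun n : ℕ => encodeBits n.bits := by fun_prop
  unfold encodeRaw encodeNum
  simp only [encodeNat_eq_bits]
  fun_prop

theorem encodeRawPair_polyTime : PolyTime fun p : List ℕ × List RawConstraint × ℕ =>
    encodeRawPair p.1.length p.2.1 p.2.2 := by
  have : PolyTime (Sum.inl : Sym → Sym ⊕ Bool) := .of_finite _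
  have : PolyTime (Sum.inr : Bool → Sym ⊕ Bool) := .of_finite _
  simp only [encodeRawPair, encodeNat_eq_bits, ← List.map_const']
  fun_prop

/-- If the squares of the scaled coefficients sum to more than this, the answer is yes. -/
def squareBound (r k : ℕ) : ℕ := 4 * 9 ^ r * (2 ^ r * k) ^ 2

/-- The kernelization on words. The word of length `0` is that of a trivial Yes-instance. -/
noncomputable def kernelWord (r : ℕ) (w : List (Sym ⊕ Bool)) : List (Sym ⊕ Bool) :=
  let ts := collect ((parse w).1.flatMap (terms r))
  if (ts.map fun t => t.2.natAbs * t.2.natAbs).sum ≤ squareBound r (parse w).2 then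
    encodeRawPair (termVars ts).length (ts.map (rawParity r (termVars ts))) (2 ^ r * (parse w).2)
  else []

theorem kernelWord_polyTime (r : ℕ) : PolyTime (kernelWord r) := by
  have htermVars : PolyTime termVars := by
    unfold termVars
    fun_prop
  have hword : PolyTime fun p : List Term × ℕ => encodeRawPair (termVars p.1).length
      (p.1.map (rawParity r (termVars p.1))) (2 ^ r * p.2) :=
    encodeRawPair_polyTime.comp (f := fun p : List Term × ℕ =>
      (termVars p.1, p.1.map (rawParity r (termVars p.1)), 2 ^ r * p.2)) (by fun_prop)
  have hsmall : PolyTime fun p : List Term × ℕ =>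
      decide ((p.1.map fun t => t.2.natAbs * t.2.natAbs).sum ≤ squareBound r p.2) := by
    unfold squareBound
    simp only [sq]
    fun_prop
  have h := hsmall.cond hword (.const [])
  simp only [Bool.cond_decide] at h
  exact h.comp (f := fun w => (collect ((parse w).1.flatMap (terms r)), (parse w).2))
    (by fun_prop)

end MaxCSPKernel

/-! ### The expansion of an instance -/

namespace MaxCSPKernel

open MaxCSP

section Expansion

open Finset

variable {r : ℕ}

theorem evalTerms_flatMap {ι : Type*} (l : List ι) (f : ι → List Term) (T : Finset ℕ) :
    evalTerms (l.flatMap f) T = (l.map fun i => evalTerms (f i) T).sum := by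
  induction l with
  | nil => rfl
  | cons i l ih =>
    rw [List.flatMap_cons, List.map_cons, List.sum_cons, ← ih, evalTerms, List.map_append,
      List.sum_append]
    rfl

theorem getD_injective {l : List ℕ} (hl : l.Nodup) :
    Function.Injective fun i : Fin l.length => l.getD i 0 := by
  intro i j h
  simp only [List.getD_eq_getElem _ _ (Fin.is_lt _)] at h
  exact Fin.ext (hl.getElem_inj_iff.mp h)

/-- The constant term of the Fourier expansion of a constraint, scaled by `2 ^ r`. -/
noncomputable def constantTerm (r : ℕ) (c : RawConstraint) : ℤ :=
  2 ^ (r - c.1.length) * walshSum .univ (tableIndicator c.1.length c.2.1) ∅ * c.2.2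

theorem constantTerm_add_evalTerms {c : RawConstraint} (hr : c.1.length ≤ r)
    (ht : c.2.1.length = 2 ^ c.1.length) (hc : c.1.Nodup) (T : Finset ℕ) :
    constantTerm r c + evalTerms (terms r c) T =
      2 ^ r * (tableIndicator c.1.length c.2.1 {i | c.1.getD i 0 ∈ T} * c.2.2) := by
  set U : Finset (Fin c.1.length) := {i | c.1.getD i 0 ∈ T}
  set F := walshSum univ (tableIndicator c.1.length c.2.1)
  have hwalsh (S : Finset (Fin c.1.length)) :
      walsh (S.toList.map fun i : Fin _ => c.1.getD i 0).toFinset T = walsh S U := by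
    rw [← walsh_image (T' := T) (getD_injective hc).injOn fun i _ => by simp [U]]
    congr 1
    ext v
    simp
  rw [terms, if_pos ⟨hr, ht⟩, evalTerms, List.map_map, sum_map_toList]
  simp only [Function.comp_def, hwalsh]
  calc constantTerm r c + ∑ S ∈ univ.erase ∅, 2 ^ (r - c.1.length) * F S * c.2.2 * walsh S U
      = ∑ S, 2 ^ (r - c.1.length) * F S * c.2.2 * walsh S U := by
        rw [← add_sum_erase univ _ (mem_univ ∅), walsh_empty_left, mul_one, constantTerm]
    _ = 2 ^ (r - c.1.length) * c.2.2 * walshSum univ F U := by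
        rw [walshSum, mul_sum, powerset_univ]
        exact sum_congr rfl fun S _ => by ring
    _ = 2 ^ (r - c.1.length) * 2 ^ c.1.length *
          (tableIndicator c.1.length c.2.1 U * c.2.2) := by
        rw [walshSum_walshSum _ (subset_univ U), card_univ, Fintype.card_fin]
        ring
    _ = _ := by rw [← pow_add, Nat.sub_add_cancel hr]

/-- The assignment in which exactly the members of `T` are true. -/
def assignment (n : ℕ) (T : Finset ℕ) (i : Fin n) : Bool := decide ((i : ℕ) ∈ T)

variable {n : ℕ}

theorem length_vars (c : Constraint r n) : c.vars.length = c.arity := List.length_ofFn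

theorem nodup_vars (c : Constraint r n) : c.vars.Nodup :=
  List.nodup_ofFn.mpr fun _ _ h => c.scope.injective (Fin.ext h)

theorem getD_vars (c : Constraint r n) (i : Fin c.arity) : c.vars.getD i 0 = c.scope i := by
  simp [Constraint.vars]

theorem tableIndicator_truthTable (c : Constraint r n) (T : Finset ℕ) :
    tableIndicator c.vars.length c.truthTable {i | c.vars.getD i 0 ∈ T} =
      (c.sat (assignment n T)).toNat := by
  have hcast {a b : ℕ} (h : a = b) (f : Fin a → Bool) :
      Nat.ofBits f = Nat.ofBits fun i : Fin b => f (i.cast h.symm) := by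
    subst h
    rfl
  rw [tableIndicator, hcast (length_vars c), Constraint.truthTable, List.getD_eq_getElem _ _
    (by simpa using Nat.ofBits_lt_two_pow _), List.getElem_map, List.getElem_range]
  refine congrArg (fun y => ((c.func y).toNat : ℤ)) (funext fun i => ?_)
  rw [Nat.testBit_ofBits_lt _ _ i.is_lt]
  exact decide_eq_decide.mpr (by rw [mem_filter_univ, Fin.val_cast, getD_vars])

theorem constantTerm_add_evalTerms_raw (c : Constraint r n) (T : Finset ℕ) :
    constantTerm r (raw c) + evalTerms (terms r (raw c)) T =
      2 ^ r * if c.sat (assignment n T) then (c.weight : ℤ) else 0 := by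
  rw [constantTerm_add_evalTerms ((length_vars c).trans_le c.arity_le) _ (nodup_vars c)]
  · rw [raw, tableIndicator_truthTable]
    cases c.sat (assignment n T) <;> simp
  · simp [raw, length_vars, Constraint.truthTable]

theorem satWeight_eq_sum (I : Instance r) (x : Fin I.n → Bool) :
    I.satWeight x = (I.constraints.map fun c => if c.sat x then c.weight else 0).sum := by
  rw [Instance.satWeight]
  induction I.constraints with
  | nil => rfl
  | cons c cs ih => cases h : c.sat x <;> simp [h, ih]

theorem assignment_surjective (n : ℕ) : Function.Surjective (assignment n) := by
  intro x
  refine ⟨(univ.filter fun i => x i).map Fin.valEmbedding, funext fun i => ?_⟩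
  simp [assignment, Fin.val_inj]

theorem sum_assignment {M : Type*} [AddCommMonoid M] (n : ℕ) (f : (Fin n → Bool) → M) :
    ∑ T ∈ (range n).powerset, f (assignment n T) = ∑ x, f x := by
  refine sum_nbij (assignment n) (fun _ _ => mem_univ _) ?_ ?_ fun _ _ => rfl
  · intro T hT T' hT' h
    rw [mem_coe, mem_powerset] at hT hT'
    ext v
    by_cases hv : v < n
    · simpa [assignment] using congrFun h ⟨v, hv⟩
    · exact iff_of_false (fun h => hv (mem_range.mp (hT h))) fun h => hv (mem_range.mp (hT' h))
  · intro x _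
    obtain ⟨T, rfl⟩ := assignment_surjective n x
    refine ⟨T ∩ range n, mem_powerset.mpr inter_subset_right, funext fun i => ?_⟩
    simp [assignment]

end Expansion

section Collect

open Finset

variable {ts : List Term} {W : Finset ℕ}

theorem coefficient_cons (t : Term) (ts : List Term) (S : Finset ℕ) :
    coefficient (t :: ts) S = (if t.1.toFinset = S then t.2 else 0) + coefficient ts S := by
  by_cases h : t.1.toFinset = S <;> simp [coefficient, h]

theorem coefficient_eq_zero {S : Finset ℕ} (h : ∀ t ∈ ts, t.1.toFinset ≠ S) :
    coefficient ts S = 0 := by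
  rw [coefficient, List.filter_eq_nil_iff.mpr fun t ht => by simpa using h t ht, List.map_nil,
    List.sum_nil]

theorem evalTerms_eq_walshSum (hW : ∀ t ∈ ts, t.1.toFinset ⊆ W) (T : Finset ℕ) :
    evalTerms ts T = walshSum W (coefficient ts) T := by
  induction ts with
  | nil => simp [evalTerms, walshSum, coefficient]
  | cons t ts ih =>
    rw [List.forall_mem_cons] at hW
    simp only [walshSum, coefficient_cons, add_mul, ite_mul, zero_mul, sum_add_distrib,
      sum_ite_eq, mem_powerset, if_pos hW.1]
    rw [← walshSum, ← ih hW.2, evalTerms, List.map_cons, List.sum_cons, evalTerms]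

theorem nodup_map_toFinset_supports (ts : List Term) :
    ((supports ts).map List.toFinset).Nodup :=
  List.pairwise_map.mpr (List.pairwise_pwFilter _)

theorem supports_subset (ts : List Term) : supports ts ⊆ ts.map Prod.fst :=
  List.pwFilter_subset _

theorem exists_mem_supports {t : Term} (ht : t ∈ ts) :
    ∃ s ∈ supports ts, s.toFinset = t.1.toFinset := by
  by_contra! h
  refine (List.forall_mem_pwFilter (fun {x y z} hxz => ?_) t.1 _).mp
    (fun s hs => (h s hs).symm) t.1 (List.mem_map_of_mem ht) rfl
  by_contra! hxyz
  exact hxz (hxyz.1.trans hxyz.2)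

theorem sum_collect {g : Finset ℕ → ℤ → ℤ} (hg : ∀ S, g S 0 = 0)
    (hW : ∀ t ∈ ts, t.1.toFinset ⊆ W) :
    ((collect ts).map fun t => g t.1.toFinset t.2).sum =
      ∑ S ∈ W.powerset, g S (coefficient ts S) := by
  have hfilter (l : List Term) : ((l.filter fun t => t.2 ≠ 0).map fun t => g t.1.toFinset t.2).sum =
      (l.map fun t => g t.1.toFinset t.2).sum := by
    induction l with
    | nil => rfl
    | cons t l ih => by_cases h : t.2 = 0 <;> simp [h, hg, ← ih]
  calc ((collect ts).map fun t => g t.1.toFinset t.2).sum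
      = (((supports ts).map List.toFinset).map fun S => g S (coefficient ts S)).sum := by
        rw [collect, hfilter, List.map_map, List.map_map]
        rfl
    _ = ∑ S ∈ ((supports ts).map List.toFinset).toFinset, g S (coefficient ts S) :=
        (List.sum_toFinset _ (nodup_map_toFinset_supports ts)).symm
    _ = ∑ S ∈ W.powerset, g S (coefficient ts S) := by
        refine sum_subset (fun S hS => ?_) fun S _ hS => ?_
        · obtain ⟨s, hs, rfl⟩ := List.mem_map.mp (List.mem_toFinset.mp hS)
          obtain ⟨t, ht, rfl⟩ := List.mem_map.mp (supports_subset ts hs)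
          exact mem_powerset.mpr (hW t ht)
        · rw [coefficient_eq_zero, hg]
          rintro t ht rfl
          obtain ⟨s, hs, hst⟩ := exists_mem_supports ht
          exact hS (List.mem_toFinset.mpr (List.mem_map.mpr ⟨s, hs, hst⟩))

theorem evalTerms_collect (ts : List Term) (T : Finset ℕ) :
    evalTerms (collect ts) T = evalTerms ts T := by
  have hW : ∀ t ∈ ts, t.1.toFinset ⊆ (ts.flatMap Prod.fst).toFinset := fun t ht v hv =>
    List.mem_toFinset.mpr (List.mem_flatMap.mpr ⟨t, ht, List.mem_toFinset.mp hv⟩)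
  rw [evalTerms_eq_walshSum hW, walshSum, evalTerms,
    sum_collect (g := fun S z => z * walsh S T) (fun S => zero_mul _) hW]

theorem exists_mem_of_mem_collect {t : Term} (ht : t ∈ collect ts) : ∃ u ∈ ts, u.1 = t.1 := by
  obtain ⟨s, hs, rfl⟩ := List.mem_map.mp (List.mem_of_mem_filter ht)
  exact List.mem_map.mp (supports_subset ts hs)

theorem ne_zero_of_mem_collect {t : Term} (ht : t ∈ collect ts) : t.2 ≠ 0 := by
  simpa using List.of_mem_filter ht

end Collect

end MaxCSPKernel

namespace MaxCSPKernel

open MaxCSP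

section Answer

open Finset

variable {r k : ℕ}

/-- The sum of the terms `ts`, none of which is constant, is `m` times the satisfied weight, up to
an additive constant. -/
structure IsExpansion (I : Instance r) (m : ℕ) (ts : List Term) : Prop where
  ne_nil : ∀ t ∈ ts, t.1 ≠ []
  lt_n : ∀ t ∈ ts, ∀ v ∈ t.1, v < I.n
  exists_const : ∃ C : ℤ, ∀ T, m * (I.satWeight (assignment I.n T) : ℤ) = C + evalTerms ts T

theorem IsExpansion.toFinset_subset {I : Instance r} {m : ℕ} {ts : List Term}
    (h : IsExpansion I m ts) : ∀ t ∈ ts, t.1.toFinset ⊆ range I.n :=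
  fun t ht v hv => mem_range.mpr (h.lt_n t ht v (List.mem_toFinset.mp hv))

theorem IsExpansion.coefficient_empty {I : Instance r} {m : ℕ} {ts : List Term}
    (h : IsExpansion I m ts) : coefficient ts ∅ = 0 :=
  coefficient_eq_zero fun t ht => (List.toFinset_eq_empty_iff t.1).not.mpr (h.ne_nil t ht)

theorem IsExpansion.mul_average {I : Instance r} {m : ℕ} {ts : List Term}
    (h : IsExpansion I m ts) (T : Finset ℕ) :
    m * (I.satWeight (assignment I.n T) : ℚ) = m * I.average + evalTerms ts T := by
  obtain ⟨C, hC⟩ := h.exists_const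
  have hsum : ∑ T ∈ (range I.n).powerset, evalTerms ts T = 0 := by
    simp only [evalTerms_eq_walshSum h.toFinset_subset]
    rw [sum_walshSum, h.coefficient_empty, mul_zero]
  have hav : m * I.average = C := by
    rw [Instance.average, ← mul_div_assoc, div_eq_iff (by positivity), mul_sum,
      ← sum_assignment]
    have htotal : ∑ T ∈ (range I.n).powerset, (m * I.satWeight (assignment I.n T) : ℤ) =
        C * 2 ^ I.n := by
      simp only [hC, sum_add_distrib, hsum, add_zero, sum_const, card_powerset, card_range]
      rw [nsmul_eq_mul, mul_comm]
      push_cast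
      rfl
    exact_mod_cast htotal
  rw [hav]
  exact_mod_cast hC T

theorem IsExpansion.mem_yes_iff {I : Instance r} {m : ℕ} {ts : List Term}
    (h : IsExpansion I m ts) (hm : 0 < m) :
    (I, k) ∈ (MaxCSPAA r).yes ↔ ∃ T, m * (k : ℤ) ≤ evalTerms ts T := by
  change (∃ x, I.average + k ≤ (I.satWeight x : ℚ)) ↔ _
  rw [(assignment_surjective I.n).exists]
  refine exists_congr fun T => ?_
  rw [← mul_le_mul_iff_of_pos_left (a := (m : ℚ)) (by positivity), h.mul_average, mul_add,
    add_le_add_iff_left]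
  norm_cast

end Answer

section InstanceTerms

open Finset

variable {r k : ℕ}

/-- The terms of the Fourier expansion of an instance, scaled by `2 ^ r`, without the constant
one. -/
noncomputable def instanceTerms (I : Instance r) : List Term :=
  collect ((I.constraints.map raw).flatMap (terms r))

theorem mem_terms_raw {n : ℕ} {c : Constraint r n} {t : Term} (ht : t ∈ terms r (raw c)) :
    t.1 ≠ [] ∧ t.1.Nodup ∧ t.1.length ≤ r ∧ ∀ v ∈ t.1, v < n := by
  have hle : (raw c).1.length ≤ r := (length_vars c).trans_le c.arity_le
  rw [terms] at ht
  split_ifs at ht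
  · obtain ⟨S, hS, rfl⟩ := List.mem_map.mp ht
    rw [mem_toList, mem_erase] at hS
    refine ⟨by simpa [nonempty_iff_ne_empty] using hS.1,
      S.nodup_toList.map (getD_injective (nodup_vars c)), ?_, ?_⟩
    · rw [List.length_map, length_toList]
      exact (card_le_univ S).trans ((Fintype.card_fin _).trans_le hle)
    · intro v hv
      obtain ⟨i, -, rfl⟩ := List.mem_map.mp hv
      rw [List.getD_eq_getElem _ _ i.is_lt]
      obtain ⟨j, hj⟩ := List.mem_ofFn.mp (List.getElem_mem (l := c.vars) i.is_lt)
      exact (congrArg (· < n) hj).mp (c.scope j).is_lt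
  · simp at ht

theorem mem_flatMap_terms {I : Instance r} {t : Term}
    (ht : t ∈ (I.constraints.map raw).flatMap (terms r)) :
    t.1 ≠ [] ∧ t.1.Nodup ∧ t.1.length ≤ r ∧ ∀ v ∈ t.1, v < I.n := by
  rw [List.flatMap_map] at ht
  obtain ⟨c, -, htc⟩ := List.mem_flatMap.mp ht
  exact mem_terms_raw htc

theorem mem_instanceTerms {I : Instance r} {t : Term} (ht : t ∈ instanceTerms I) :
    t.1 ≠ [] ∧ t.1.Nodup ∧ t.1.length ≤ r ∧ ∀ v ∈ t.1, v < I.n := by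
  obtain ⟨u, hu, hut⟩ := exists_mem_of_mem_collect ht
  exact hut ▸ mem_flatMap_terms hu

theorem isExpansion_instanceTerms (I : Instance r) : IsExpansion I (2 ^ r) (instanceTerms I) where
  ne_nil _ ht := (mem_instanceTerms ht).1
  lt_n _ ht := (mem_instanceTerms ht).2.2.2
  exists_const := by
    refine ⟨(I.constraints.map fun c => constantTerm r (raw c)).sum, fun T => ?_⟩
    rw [instanceTerms, evalTerms_collect, List.flatMap_map, evalTerms_flatMap, satWeight_eq_sum]
    induction I.constraints with
    | nil => simp
    | cons c cs ih =>
      have hc := constantTerm_add_evalTerms_raw c T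
      simp only [List.map_cons, List.sum_cons, Nat.cast_add, Nat.cast_ite, Nat.cast_zero] at ih ⊢
      rw [mul_add, ih, Nat.cast_pow, Nat.cast_two, ← hc]
      ring

theorem mem_yes_of_squareBound_lt {I : Instance r}
    (h : squareBound r k < ((instanceTerms I).map fun t => t.2.natAbs * t.2.natAbs).sum) :
    (I, k) ∈ (MaxCSPAA r).yes := by
  rw [(isExpansion_instanceTerms I).mem_yes_iff (by positivity)]
  by_contra! hlt
  set ts := (I.constraints.map raw).flatMap (terms r)
  have hW : ∀ t ∈ ts, t.1.toFinset ⊆ range I.n := fun t ht v hv =>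
    mem_range.mpr ((mem_flatMap_terms ht).2.2.2 v (List.mem_toFinset.mp hv))
  have hdegree : ∀ S ⊆ range I.n, r < #S → coefficient ts S = 0 := by
    refine fun S _ hS => coefficient_eq_zero ?_
    rintro t ht rfl
    exact hS.not_ge (t.1.toFinset_card_le.trans (mem_flatMap_terms ht).2.2.1)
  have hempty : coefficient ts ∅ = 0 := coefficient_eq_zero fun t ht =>
    (List.toFinset_eq_empty_iff t.1).not.mpr (mem_flatMap_terms ht).1
  have hle : ∀ T ⊆ range I.n, walshSum (range I.n) (coefficient ts) T ≤ 2 ^ r * k := by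
    intro T _
    rw [← evalTerms_eq_walshSum hW, ← evalTerms_collect]
    exact_mod_cast (hlt T).le
  have hsum := sum_sq_le_of_walshSum_le hdegree hempty (by positivity) hle
  rw [← sum_collect (g := fun _ z => z ^ 2) (fun _ => zero_pow two_ne_zero) hW] at hsum
  refine h.not_ge ?_
  rw [← Nat.cast_le (α := ℤ), squareBound]
  push_cast [Function.comp_def, List.map_map]
  simp only [← sq, sq_abs]
  exact hsum

end InstanceTerms

end MaxCSPKernel

namespace MaxCSPKernel

open MaxCSP

section ParityInstance

open Finset

variable {r : ℕ} {W : List ℕ} {t : Term} {ts : List Term}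

/-- The terms that can be written as a parity constraint on at most `r` of the variables in `W`. -/
structure IsParityTerm (r : ℕ) (W : List ℕ) (t : Term) : Prop where
  ne_nil : t.1 ≠ []
  nodup : t.1.Nodup
  length_le : t.1.length ≤ r
  subset : t.1 ⊆ W
  ne_zero : t.2 ≠ 0

/-- The constraint whose weight minus its average is the term `t`, the variables being renumbered
by their positions in `W`. -/
def parityConstraint (r : ℕ) (W : List ℕ) (t : Term) (ht : IsParityTerm r W t) :
    Constraint r W.length where
  arity := t.1.length
  arity_le := ht.length_le
  scope :=
    ⟨fun i => ⟨W.idxOf t.1[i], List.idxOf_lt_length_of_mem (ht.subset (List.getElem_mem _))⟩,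
      fun i j h => Fin.ext (ht.nodup.getElem_inj_iff.mp
        ((List.idxOf_inj (ht.subset (List.getElem_mem _))).mp (Fin.val_eq_of_eq h)))⟩
  func := parityFunc t.1.length (decide (t.2 < 0))
  weight := 2 * t.2.natAbs
  weight_pos := Nat.mul_pos two_pos (Int.natAbs_pos.mpr ht.ne_zero)

/-- The instance that consists of the parity constraints of the terms `ts`. -/
def parityInstance (r : ℕ) (W : List ℕ) (ts : List Term) (h : ∀ t ∈ ts, IsParityTerm r W t) :
    Instance r :=
  ⟨W.length, ts.pmap (parityConstraint r W) h⟩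

theorem vars_parityConstraint (ht : IsParityTerm r W t) :
    (parityConstraint r W t ht).vars = t.1.map W.idxOf := by
  refine List.ext_getElem (by simp [Constraint.vars, parityConstraint]) fun i _ _ => ?_
  simp only [Constraint.vars, List.getElem_ofFn, List.getElem_map]
  rfl

theorem raw_parityConstraint (ht : IsParityTerm r W t) :
    raw (parityConstraint r W t ht) = rawParity r W t := by
  rw [raw, vars_parityConstraint, rawParity, if_pos ht.length_le]
  rfl

theorem raw_parityInstance (h : ∀ t ∈ ts, IsParityTerm r W t) :
    (parityInstance r W ts h).constraints.map raw = ts.map (rawParity r W) := by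
  rw [parityInstance, List.map_pmap]
  simp only [raw_parityConstraint, List.pmap_eq_map]

theorem sat_parityConstraint_iff (ht : IsParityTerm r W t) (T : Finset ℕ) :
    (parityConstraint r W t ht).sat (assignment W.length T) ↔
      walsh (t.1.map W.idxOf).toFinset T = if t.2 < 0 then -1 else 1 := by
  set c := parityConstraint r W t ht
  have hwalsh : walsh univ {i | assignment W.length T (c.scope i)} =
      walsh (t.1.map W.idxOf).toFinset T := by
    rw [← walsh_image (T' := T) (fun i _ j _ h => c.scope.injective (Fin.ext h)) fun i _ => by
      rw [mem_filter_univ, assignment, decide_eq_true_iff]]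
    congr 1
    ext v
    simp [← vars_parityConstraint ht, Constraint.vars, c]
  change decide (walsh univ {i | assignment W.length T (c.scope i)} =
    if decide (t.2 < 0) then -1 else 1) ↔ _
  rw [decide_eq_true_iff, hwalsh]
  simp only [decide_eq_true_iff]

theorem weight_parityConstraint (ht : IsParityTerm r W t) (T : Finset ℕ) :
    (if (parityConstraint r W t ht).sat (assignment W.length T) then
      (parityConstraint r W t ht).weight else 0 : ℤ) =
      |t.2| + t.2 * walsh (t.1.map W.idxOf).toFinset T := by
  simp only [sat_parityConstraint_iff, Int.abs_eq_natAbs]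
  rw [show (parityConstraint r W t ht).weight = 2 * t.2.natAbs from rfl]
  rcases walsh_eq_one_or (t.1.map W.idxOf).toFinset T with h | h <;> rw [h] <;> split_ifs <;>
    first | omega | contradiction

theorem isExpansion_parityInstance (h : ∀ t ∈ ts, IsParityTerm r W t) :
    IsExpansion (parityInstance r W ts h) 1 (ts.map fun t => (t.1.map W.idxOf, t.2)) where
  ne_nil := List.forall_mem_map.mpr fun t ht => by simpa using (h t ht).ne_nil
  lt_n := List.forall_mem_map.mpr fun t ht => List.forall_mem_map.mpr fun v hv =>
    List.idxOf_lt_length_of_mem ((h t ht).subset hv)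
  exists_const := by
    refine ⟨(ts.map fun t => |t.2|).sum, fun T => ?_⟩
    rw [satWeight_eq_sum, evalTerms, List.map_map, parityInstance]
    dsimp only
    induction ts with
    | nil => rfl
    | cons t ts ih =>
      rw [List.forall_mem_cons] at h
      have hc := weight_parityConstraint h.1 T
      have ih := ih h.2
      rw [Nat.cast_one, one_mul] at ih ⊢
      rw [List.pmap_cons, List.map_cons, List.sum_cons, Nat.cast_add, ih, Nat.cast_ite,
        Nat.cast_zero, hc, List.map_cons, List.map_cons, List.sum_cons, List.sum_cons]
      simp only [Function.comp_apply]
      ring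

theorem evalTerms_map_idxOf (h : ∀ t ∈ ts, t.1 ⊆ W) {T T' : Finset ℕ}
    (hT : ∀ v ∈ W, W.idxOf v ∈ T' ↔ v ∈ T) :
    evalTerms (ts.map fun t => (t.1.map W.idxOf, t.2)) T' = evalTerms ts T := by
  rw [evalTerms, evalTerms, List.map_map]
  congr 1
  refine List.map_congr_left fun t ht => ?_
  have himage : (t.1.map W.idxOf).toFinset = t.1.toFinset.image W.idxOf := by
    ext v
    simp
  rw [Function.comp_apply, himage]
  have hW : ∀ v ∈ t.1.toFinset, v ∈ W := fun v hv => h t ht (List.mem_toFinset.mp hv)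
  rw [walsh_image (fun u hu v _ huv => (List.idxOf_inj (hW u hu)).mp huv)
    fun v hv => hT v (hW v hv)]

theorem mem_yes_parityInstance_iff {k : ℕ} (h : ∀ t ∈ ts, IsParityTerm r W t) :
    (parityInstance r W ts h, k) ∈ (MaxCSPAA r).yes ↔ ∃ T, (k : ℤ) ≤ evalTerms ts T := by
  have hW : ∀ t ∈ ts, t.1 ⊆ W := fun t ht => (h t ht).subset
  rw [(isExpansion_parityInstance h).mem_yes_iff one_pos, Nat.cast_one, one_mul]
  constructor
  · rintro ⟨T', hT'⟩
    exact ⟨W.toFinset.filter fun v => W.idxOf v ∈ T', hT'.trans_eq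
      (evalTerms_map_idxOf hW fun v hv => by simp [hv])⟩
  · rintro ⟨T, hT⟩
    refine ⟨(W.toFinset.filter fun v => v ∈ T).image W.idxOf, hT.trans_eq
      (evalTerms_map_idxOf hW fun v hv => ?_).symm⟩
    simp only [mem_image, mem_filter, List.mem_toFinset]
    exact ⟨fun ⟨u, ⟨hu, huT⟩, huv⟩ => (List.idxOf_inj hu).mp huv ▸ huT,
      fun hvT => ⟨v, ⟨hv, hvT⟩, rfl⟩⟩

end ParityInstance

section Kernel

variable {r : ℕ}

theorem isParityTerm_of_mem_instanceTerms {I : Instance r} :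
    ∀ t ∈ instanceTerms I, IsParityTerm r (termVars (instanceTerms I)) t := by
  intro t ht
  obtain ⟨hnil, hnodup, hlength, -⟩ := mem_instanceTerms ht
  exact ⟨hnil, hnodup, hlength, fun v hv => List.mem_dedup.mpr (List.mem_flatMap.mpr ⟨t, ht, hv⟩),
    ne_zero_of_mem_collect ht⟩

/-- The kernelization: an instance whose scaled Fourier coefficients are large is replaced by a
trivial Yes-instance, any other one by parity constraints with the same expansion. -/
noncomputable def kernel (r : ℕ) (p : Instance r × ℕ) : Instance r × ℕ :=
  if ((instanceTerms p.1).map fun t => t.2.natAbs * t.2.natAbs).sum ≤ squareBound r p.2 then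
    (parityInstance r (termVars (instanceTerms p.1)) (instanceTerms p.1)
      isParityTerm_of_mem_instanceTerms, 2 ^ r * p.2)
  else (⟨0, []⟩, 0)

theorem kernelWord_encodePair (p : Instance r × ℕ) :
    kernelWord r ((MaxCSPAA r).encodePair p) = (MaxCSPAA r).encodePair (kernel r p) := by
  obtain ⟨I, k⟩ := p
  refine (congrArg (kernelWord r) (encodePair_eq I k)).trans ?_
  rw [kernelWord, parse_encodeRawPair, kernel]
  dsimp only
  rw [← instanceTerms]
  split_ifs with h
  · exact (encodePair_eq _ _).symm ▸ raw_parityInstance isParityTerm_of_mem_instanceTerms ▸ rfl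
  · rfl

theorem trivial_mem_yes : ((⟨0, []⟩, 0) : Instance r × ℕ) ∈ (MaxCSPAA r).yes :=
  ⟨fun _ => false, by simp [Instance.average, Instance.satWeight]⟩

theorem kernel_mem_yes_iff (I : Instance r) (k : ℕ) :
    (I, k) ∈ (MaxCSPAA r).yes ↔ kernel r (I, k) ∈ (MaxCSPAA r).yes := by
  rw [kernel]
  split_ifs with h
  · rw [mem_yes_parityInstance_iff, (isExpansion_instanceTerms I).mem_yes_iff (by positivity)]
    push_cast
    rfl
  · exact iff_of_true (mem_yes_of_squareBound_lt (not_le.mp h)) trivial_mem_yes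

theorem kernel_snd_le (p : Instance r × ℕ) : (kernel r p).2 ≤ 2 ^ r * p.2 := by
  rw [kernel]
  split_ifs with h
  exacts [le_rfl, Nat.zero_le _]

theorem length_encodeNum_le (m : ℕ) : (encodeNum m).length ≤ m + 1 := by
  rw [encodeNum, encodeBits, List.length_append, List.length_map, encodeNat_eq_bits,
    Nat.size_eq_bits_len]
  exact Nat.succ_le_succ (Nat.size_le.mpr Nat.lt_two_pow_self)

theorem sum_map_le_length_mul {ι : Type*} {l : List ι} {f : ι → ℕ} {B : ℕ}
    (h : ∀ i ∈ l, f i ≤ B) : (l.map f).sum ≤ l.length * B := by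
  simpa using List.sum_le_card_nsmul (l.map f) B (List.forall_mem_map.mpr h)

theorem length_encodeRaw_le {c : RawConstraint} {N : ℕ} (hN : ∀ v ∈ c.1, v ≤ N) :
    (encodeRaw c).length ≤ c.1.length * (N + 2) + c.2.1.length + c.2.2 + 3 := by
  have hvars : (c.1.flatMap fun v => Sym.arg :: encodeNum v).length ≤ c.1.length * (N + 2) := by
    rw [List.length_flatMap]
    refine sum_map_le_length_mul fun v hv => ?_
    rw [List.length_cons]
    have := length_encodeNum_le v
    have := hN v hv
    omega
  have := length_encodeNum_le c.2.2
  simp only [encodeRaw, encodeBits, List.length_append, List.length_cons, List.length_map,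
    List.length_nil]
  omega

theorem length_termVars_le {ts : List Term} (h : ∀ t ∈ ts, t.1.length ≤ r) :
    (termVars ts).length ≤ ts.length * r := by
  refine (List.dedup_sublist _).length_le.trans ?_
  rw [List.length_flatMap]
  exact sum_map_le_length_mul h

theorem natAbs_le_of_sum_le {ts : List Term} {B : ℕ}
    (hB : (ts.map fun t => t.2.natAbs * t.2.natAbs).sum ≤ B) : ∀ t ∈ ts, t.2.natAbs ≤ B :=
  fun _ ht => (Nat.le_mul_self _).trans
    ((List.single_le_sum (fun _ _ => Nat.zero_le _) _ (List.mem_map_of_mem ht)).trans hB)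

theorem length_le_of_sum_le {ts : List Term} (h : ∀ t ∈ ts, t.2 ≠ 0) {B : ℕ}
    (hB : (ts.map fun t => t.2.natAbs * t.2.natAbs).sum ≤ B) : ts.length ≤ B := by
  refine le_trans ?_ hB
  simpa using List.card_nsmul_le_sum (ts.map fun t => t.2.natAbs * t.2.natAbs) 1
    (List.forall_mem_map.mpr fun t ht => Nat.mul_pos (Int.natAbs_pos.mpr (h t ht))
      (Int.natAbs_pos.mpr (h t ht)))

theorem length_encode_parityInstance_le {W : List ℕ} {ts : List Term} {B : ℕ}
    (h : ∀ t ∈ ts, IsParityTerm r W t) (hB : ∀ t ∈ ts, t.2.natAbs ≤ B) :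
    (parityInstance r W ts h).encode.length ≤
      W.length + ts.length * (r * (W.length + 2) + 2 ^ r + 2 * B + 3) := by
  have henc : (parityInstance r W ts h).encode =
      List.replicate W.length Sym.var ++ (ts.map (rawParity r W)).flatMap encodeRaw := by
    rw [← raw_parityInstance h, List.flatMap_map]
    rfl
  rw [henc, List.length_append, List.length_replicate, List.length_flatMap, List.map_map]
  refine Nat.add_le_add_left (sum_map_le_length_mul fun t ht => ?_) _
  have htable : (rawParity r W t).2.1.length = 2 ^ t.1.length := by
    simp [rawParity, parityTable, (h t ht).length_le]
  have hlength := (h t ht).length_le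
  have hweight := hB t ht
  calc (encodeRaw (rawParity r W t)).length
      ≤ (t.1.map W.idxOf).length * (W.length + 2) + (rawParity r W t).2.1.length +
          2 * t.2.natAbs + 3 :=
        length_encodeRaw_le (List.forall_mem_map.mpr fun v _ => List.idxOf_le_length)
    _ ≤ r * (W.length + 2) + 2 ^ r + 2 * B + 3 := by
      rw [htable, List.length_map]
      gcongr
      exact one_le_two

/-- A bound on the size of the kernel, as a polynomial in the parameter. -/
noncomputable def sizeBound (r : ℕ) : Polynomial ℕ :=
  let B : Polynomial ℕ := 4 * 9 ^ r * (2 ^ r * .X) ^ 2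
  B * r + B * (r * (B * r + 2) + 2 ^ r + 2 * B + 3)

theorem size_kernel_le (I : Instance r) (k : ℕ) :
    (MaxCSPAA r).size (kernel r (I, k)).1 ≤ (sizeBound r).eval k := by
  rw [kernel]
  split_ifs with h
  · set ts := instanceTerms I
    have hts : ts.length ≤ squareBound r k :=
      length_le_of_sum_le (fun _ ht => ne_zero_of_mem_collect ht) h
    have hvars : (termVars ts).length ≤ squareBound r k * r :=
      (length_termVars_le fun _ ht => (mem_instanceTerms ht).2.2.1).trans
        (Nat.mul_le_mul_right r hts)
    calc (MaxCSPAA r).size _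
        ≤ (termVars ts).length + ts.length *
            (r * ((termVars ts).length + 2) + 2 ^ r + 2 * squareBound r k + 3) :=
          length_encode_parityInstance_le _ (natAbs_le_of_sum_le h)
      _ ≤ squareBound r k * r + squareBound r k *
            (r * (squareBound r k * r + 2) + 2 ^ r + 2 * squareBound r k + 3) := by gcongr
      _ = (sizeBound r).eval k := by simp [sizeBound, squareBound]
  · exact Nat.zero_le _

end Kernel

end MaxCSPKernel

theorem mainTheorem3 (r : ℕ) (hr : 0 < r) : (MaxCSPAA r).HasPolynomialSizeKernel :=
  ⟨MaxCSPKernel.kernel r, (2 ^ r * ·), MaxCSPKernel.sizeBound r,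
    (MaxCSPKernel.kernelWord_polyTime r).computableInPolyTime MaxCSPKernel.kernelWord_encodePair,
    MaxCSPKernel.kernel_mem_yes_iff, fun I k => MaxCSPKernel.kernel_snd_le (I, k),
    MaxCSPKernel.size_kernel_le⟩
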